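/- **Model.** Let $t_0\in(0,1)$, let $\delta_a,\delta_b\in\mathbb R$, and let $q:[0,1]\to\mathbb R$ be continuous with $q(x)=q(1-x)$. For $\theta=(\theta_1,\theta_2)\in\mathbb R^2$ let $H(\theta)$ be the Floquet fibre of the bilayer hexagonal quantum graph in $AA'$ stacking. It acts as $u\mapsto -u''+qu$ on tuples of $H^2$ functions on eight edges, each identified with $[0,1]$: the edges $a_{k1},a_{k2},a_{k3}$ of layer $k=1,2$, from vertex $A_k$ (at $0$) to vertex $B_k$ (at $1$), and two edges $f_1$ (from $A_1$ to $B_2$) and $f_2$ (from $A_2$ to $B_1$). Put $\omega_1=1$, $\omega_2=e^{i\theta_1}$, $\omega_3=e^{i\theta_2}$. For $\{k,l\}=\{1,2\}$ the functions satisfy $$u_{a_{kj}}(0)=\tfrac1{t_0}u_{f_k}(0)=:A_k,\qquad \omega_j u_{a_{kj}}(1)=\tfrac1{t_0}u_{f_l}(1)=:B_k\qquad(j=1,2,3),$$ $$\sum_j u_{a_{kj}}'(0)+t_0u_{f_k}'(0)=\delta_aA_k,\qquad -\sum_j\omega_ju_{a_{kj}}'(1)-t_0u_{f_l}'(1)=\delta_bB_k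 .$$ The dispersion relation of $H_2^{AA'}$ is the set of all $(\theta,\lambda)$, $\lambda\in\mathbb R$, such that $\lambda$ is an eigenvalue of $H(\theta)$. Let $\Sigma$ be the set of energies $\lambda$ that occur in it for some $\theta\in[-\pi,\pi]^2$, let $B_d=\{\theta\in[-\pi,\pi]^2:\theta_2=-\theta_1\}$, and let $F(\theta)=1+e^{i\theta_1}+e^{i\theta_2}$. Let $\sigma(H^D)$ be the spectrum of $-d^2/dx^2+q$ on $[0,1]$ with Dirichlet conditions. For $\lambda\notin\sigma(H^D)$ let $\varphi$ be the solution of $-\varphi''+q\varphi=\lambda\varphi$ with $\varphi(0)=0$, $\varphi(1)=1$, and put $\eta(\lambda)=\varphi'(1)/\varphi'(0)$, $\alpha_a=\delta_a/\varphi'(0)$, $\alpha_b=\delta_b/\varphi'(0)$ (so $\alpha_a=\alpha_b\neq0$ if and only if $\delta_a=\delta_b\ne0$). For $\varepsilon,\varsigma\in\{1,-1\}$ put $$r_{\varepsilon,\varsigma}(F)=\frac{-\alpha_a-\alpha_b+\varepsilon\sqrt{4|F-\varsigma t_0^2|^2+(\alpha_a-\alpha_b)^2}}{2(3+t_0^2)}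 .$$ The conduction band ($\varepsilon=1$) and the valence band ($\varepsilon=-1$) are the sets of $(\theta,\lambda)$ with $\lambda\notin\sigma(H^D)$ and $\eta(\lambda)=r_{\varepsilon,\varsigma}(F(\theta))$ for some $\varsigma$. A point $(\lambda_D,\theta_D)$ of the dispersion relation with $\theta_D\in B_d$ is a *Dirac cone* if for $(\theta,\lambda)$ near $(\theta_D,\lambda_D)$ with $\theta\in B_d$ the conduction and valence bands are the graphs of functions $\lambda^{+},\lambda^-$ with $$\lambda^\pm(\theta)=\lambda_D\pm\gamma|\theta-\theta_D|+O(|\theta-\theta_D|^2)\quad\text{for some }\gamma\neq0,\qquad \lambda^\pm(\theta_D)=\lambda_D .$$ A *gap* is an interval $(x,y)$, $x<y$, with $x,y\in\Sigma$ and $(x,y)\cap\Sigma=\emptyset$. **Theorem.** For $\theta\in B_d$ and $\varsigma=\pm1$ one has $F(\theta)=\varsigma t_0^2$ if and only if $|\theta_1|=\arccos\frac{\varsigma t_0^2-1}{2}$. For $\lambda\notin\sigma(H^D)$ and every $\theta$, $(\theta,\lambda)$ lies in the dispersion relation if and only if it lies in the conduction or the valence band. Moreover: (a) If $\delta_a=\delta_b\neq0$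 and $\theta_D\in B_d$ satisfies $F(\theta_D)=t_0^2$ or $F(\theta_D)=-t_0^2$, then $(\lambda,\theta_D)$ is a Dirac cone for every $\lambda$ with $(\theta_D,\lambda)$ in both the conduction and the valence band, and $(\lambda,\theta_D)$ is a Dirac cone for infinitely many $\lambda$. (b) If $\delta_a\neq\delta_b$, the conduction and valence bands do not touch: no energy $\lambda$ occurs both in the conduction band (for some $\theta$) and in the valence band (for some $\theta'$). The dispersion relation always has gaps: if the energies $\lambda_c$ and $\lambda_v$ occur in the conduction and in the valence band respectively, then a gap lies between them, and there are infinitely many gaps. The same holds for the root functions with arbitrary constant real $\alpha_a,\alpha_b$. If $\alpha_a=\alpha_b\ne0$ and $\theta_D\in B_d$, $F(\theta_D)=\varsigma t_0^2$, then $r_{1,\varsigma}(F(\theta_D))=r_{-1,\varsigma}(F(\theta_D))$ and there is $\gamma>0$ with $r_{\varepsilon,\varsigma}(F(\theta))-r_{\varepsilon,\varsigma}(F(\theta_D))=\varepsilon\gamma|\theta-\theta_D|+O(|\theta-\theta_D|^2)$ for $\theta\in B_d$, $\theta\to\theta_D$ and $\varepsilon=\pm1$. If $\alpha_a\neq\alpha_b$,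 then $r_{1,\varsigma}(F(\theta))-r_{-1,\varsigma'}(F(\theta'))\ge|\alpha_a-\alpha_b|/(3+t_0^2)>0$ for all $\theta,\theta'\in\mathbb R^2$ and $\varsigma,\varsigma'\in\{1,-1\}$. -/

import Mathlib

open Set Filter Topology MeasureTheory Asymptotics

namespace AAPrime

/-- An element of the Sobolev space `H²` of an edge identified with `[0,1]`: a function `val`
together with its derivatives `der` and `der2`, where `der2` is square integrable and `val`, `der`
are the primitives of `der`, `der2`.  Only the values on `[0,1]` matter; `der 0` and `der 1` are the
one-sided derivatives at the ends of the edge. -/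
structure EdgeH2 (𝕜 : Type) [RCLike 𝕜] where
  val : ℝ → 𝕜
  der : ℝ → 𝕜
  der2 : ℝ → 𝕜
  memLp : MemLp der2 2 (volume.restrict (Icc (0 : ℝ) 1))
  der_eq : ∀ x ∈ Icc (0 : ℝ) 1, der x = der 0 + ∫ y in (0 : ℝ)..x, der2 y
  val_eq : ∀ x ∈ Icc (0 : ℝ) 1, val x = val 0 + ∫ y in (0 : ℝ)..x, der y

/-- `-u'' + q u = λ u` almost everywhere on the edge. -/
def SolvesSchrodinger {𝕜 : Type} [RCLike 𝕜] (q : ℝ → ℝ) (lam : ℝ) (u : EdgeH2 𝕜) : Prop :=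
  ∀ᵐ x ∂(volume.restrict (Icc (0 : ℝ) 1)),
    -u.der2 x + (q x : 𝕜) * u.val x = (lam : 𝕜) * u.val x

/-- The spectrum of the Dirichlet operator `-d²/dx² + q` on `[0,1]`. -/
def dirichletSpectrum (q : ℝ → ℝ) : Set ℝ :=
  {lam | ∃ u : EdgeH2 ℝ, SolvesSchrodinger q lam u ∧ u.val 0 = 0 ∧ u.val 1 = 0 ∧
    ∃ x ∈ Icc (0 : ℝ) 1, u.val x ≠ 0}

/-- The edges of the fundamental domain of the bilayer: three edges `a k j` in each layer `k`, from
the vertex `A k` (at `0`) to the vertex `B k` (at `1`), and two edges between the layers; `f k`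
runs from `A k` (at `0`) to `B` of the other layer (at `1`). -/
inductive Edge where
  | a (k : Fin 2) (j : Fin 3)
  | f (k : Fin 2)

/-- The data of the model: interaction parameter, vertex parameters of the two types of atoms, and
the potential on each edge. -/
structure Bilayer where
  t : ℝ
  δa : ℝ
  δb : ℝ
  q : ℝ → ℝ

/-- Quasimomenta. -/
abbrev Momentum := EuclideanSpace ℝ (Fin 2)

/-- The Floquet phases `1, exp(iθ₁), exp(iθ₂)`. -/
noncomputable def phase (θ : Momentum) (j : Fin 3) : ℂ :=
  ![1, Complex.exp (Complex.I * (θ 0 : ℂ)), Complex.exp (Complex.I * (θ 1 : ℂ))] j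

/-- `F(θ) = 1 + exp(iθ₁) + exp(iθ₂)`. -/
noncomputable def F (θ : Momentum) : ℂ := ∑ j, phase θ j

/-- The Brillouin zone `[-π,π]²`. -/
def brillouin : Set Momentum := {θ | ∀ i, θ i ∈ Icc (-Real.pi) Real.pi}

/-- Its diagonal `θ₂ = -θ₁`, on which `F` is real. -/
def brillouinDiag : Set Momentum := {θ | θ ∈ brillouin ∧ θ 1 = -θ 0}

/-- The domain of the fibre operator `H(θ)`: `H²` on each edge, with weighted continuity and total
flow (modified Neumann) conditions at the four vertices `A k`, `B k`, and the cyclic Floquet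
condition in each layer. -/
structure InDomain (G : Bilayer) (θ : Momentum) (u : Edge → EdgeH2 ℂ) : Prop where
  cont_A : ∀ k j, (u (.a k j)).val 0 = (u (.a k 0)).val 0
  cont_B : ∀ k j, phase θ j * (u (.a k j)).val 1 = (u (.a k 0)).val 1
  weighted_A : ∀ k, (u (.f k)).val 0 / (G.t : ℂ) = (u (.a k 0)).val 0
  weighted_B : ∀ k : Fin 2, (u (.f k.rev)).val 1 / (G.t : ℂ) = (u (.a k 0)).val 1
  flow_A : ∀ k, (∑ j, (u (.a k j)).der 0) + (G.t : ℂ) * (u (.f k)).der 0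
    = (G.δa : ℂ) * (u (.a k 0)).val 0
  flow_B : ∀ k : Fin 2,
    -(∑ j, phase θ j * (u (.a k j)).der 1) - (G.t : ℂ) * (u (.f k.rev)).der 1
      = (G.δb : ℂ) * (u (.a k 0)).val 1

/-- The dispersion relation: all `(θ, λ)` such that `λ` is an eigenvalue of `H(θ)`. -/
def dispersion (G : Bilayer) : Set (Momentum × ℝ) :=
  {p | ∃ u : Edge → EdgeH2 ℂ, InDomain G p.1 u ∧ (∀ e, SolvesSchrodinger G.q p.2 (u e)) ∧
    ∃ e, ∃ x ∈ Icc (0 : ℝ) 1, (u e).val x ≠ 0}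

/-- The energies attained by the dispersion relation over the Brillouin zone. -/
def spectrumH (G : Bilayer) : Set ℝ := {lam | ∃ θ ∈ brillouin, (θ, lam) ∈ dispersion G}

/-- `φ` is the solution `φ_{λ,1}` with `φ(0) = 0`, `φ(1) = 1`. -/
def IsPhiOne (q : ℝ → ℝ) (lam : ℝ) (φ : EdgeH2 ℝ) : Prop :=
  SolvesSchrodinger q lam φ ∧ φ.val 0 = 0 ∧ φ.val 1 = 1

/-- The four roots: `ε = ±1` is the sign of the square root, `σ = ±1` that of the shift; for real
`F` the radicand is `4 (F - σ t²)² + (αa - αb)²`. -/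
noncomputable def root (ε σ αa αb t : ℝ) (F : ℂ) : ℝ :=
  (-αa - αb + ε * √(4 * ‖F - ((σ * t ^ 2 : ℝ) : ℂ)‖ ^ 2 + (αa - αb) ^ 2)) / (2 * (3 + t ^ 2))

/-- The part of `(θ, λ)`-space, away from the Dirichlet spectrum, where `η(λ) = φ'(1)/φ'(0)` is one
of the two roots with sign `ε`, the parameters being `αa = δa/φ'(0)` and `αb = δb/φ'(0)`. -/
def band (G : Bilayer) (ε : ℝ) : Set (Momentum × ℝ) :=
  {p | p.2 ∉ dirichletSpectrum G.q ∧ ∃ φ : EdgeH2 ℝ, IsPhiOne G.q p.2 φ ∧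
    ∃ σ ∈ ({1, -1} : Set ℝ),
      φ.der 1 / φ.der 0 = root ε σ (G.δa / φ.der 0) (G.δb / φ.der 0) G.t (F p.1)}

/-- The conduction band(s), sign `+`. -/
def conduction (G : Bilayer) : Set (Momentum × ℝ) := band G 1

/-- The valence band(s), sign `-`. -/
def valence (G : Bilayer) : Set (Momentum × ℝ) := band G (-1)

/-- `(λ, θD)` is a Dirac cone: near it, on the diagonal of the Brillouin zone, the conduction and
the valence band are the graphs of two functions that touch linearly at `θD`, with slopes `γ` and
`-γ`, where `γ ≠ 0`. -/
def IsDiracCone (G : Bilayer) (lam : ℝ) (θD : Momentum) : Prop :=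
  θD ∈ brillouinDiag ∧ (θD, lam) ∈ dispersion G ∧
  ∃ γ : ℝ, γ ≠ 0 ∧ ∃ lp lm : Momentum → ℝ,
    lp θD = lam ∧ lm θD = lam ∧
    (∀ᶠ p in 𝓝[brillouinDiag] θD ×ˢ 𝓝 lam,
      (p ∈ conduction G ↔ p.2 = lp p.1) ∧ (p ∈ valence G ↔ p.2 = lm p.1)) ∧
    (fun θ => lp θ - lam - γ * ‖θ - θD‖) =O[𝓝[brillouinDiag] θD] (fun θ => ‖θ - θD‖ ^ 2) ∧
    (fun θ => lm θ - lam + γ * ‖θ - θD‖) =O[𝓝[brillouinDiag] θD] (fun θ => ‖θ - θD‖ ^ 2)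

/-- `(x, y)` is a gap: no energy in between, and both end points are energies. -/
def IsGap (G : Bilayer) (x y : ℝ) : Prop :=
  x < y ∧ x ∈ spectrumH G ∧ y ∈ spectrumH G ∧ ∀ z ∈ Ioo x y, z ∉ spectrumH G

end AAPrime

/-! Let `s` solve the edge equation with `s(0) = 0`, `s'(0) = 1`, and write `S = s(1)` (`sinEnd`),
`C = s'(1)` (`sinDerEnd`). Since `q` is even about `1/2`, the Wronskian with `s` and its reflection
expresses the end derivatives of every solution through its end values, `S` and `C`. As `φ = s / S`,
one has `η = C` and `αa = δa S`, `αb = δb S`. With `Da = (3 + t²) C + δa S` and `Db = (3 + t²) C +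
δb S`, the vertex conditions become a system for the four vertex values; exchanging the layers
splits it into two 2×2 systems, solvable nontrivially iff `Da Db = |F - σ t²|²` with `σ = ±1`
(`mem_dispersion_iff`). Solving this quadratic in `C` gives the four roots.

If `δa = δb`, the bands are `Da = ε |F - σ t²|`. Zeros of `Da` are simple by Lagrange's identity
(`robin_deriv_ne_zero`), so near such a zero the bands are `λ = g(ε |F - σ t²|)` with a C² local
inverse `g`, and `|F - σ t²|` is linear to first order on the diagonal because `sin θ₁ ≠ 0` there.
At `λ = k²` one has `Da = (3 + t²) cos k + o(1)`, hence infinitely many zeros.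

If `δa ≠ δb`, the mean `M = (Da + Db) / 2` is positive on the conduction band and negative on the
valence band. Where `M = 0` one has `Da Db < 0`, whereas the energies are exactly those with `0 ≤ Da
Db ≤ (3 + t²)²` (`mem_spectrumH_iff`). So a zero of `M` between two energies lies in a gap; the
intermediate value theorem and the cosine asymptotics supply such zeros. -/

namespace AAPrime

/-! ### Classical solutions on an edge: regularity, Wronskian, uniqueness. -/

section

variable {𝕜 : Type} [RCLike 𝕜]

/-- Classical solutions of `-y'' + q y = lam y` on `[0,1]`, with `z = y'`. -/
def IsSol (q : ℝ → ℝ) (lam : ℝ) (y z : ℝ → 𝕜) : Prop :=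
  ∀ x ∈ Icc (0 : ℝ) 1, HasDerivWithinAt y (z x) (Icc 0 1) x ∧
    HasDerivWithinAt z (((q x - lam : ℝ) : 𝕜) * y x) (Icc 0 1) x

theorem hasDerivWithinAt_of_eq_primitive {f g : ℝ → 𝕜} (hg : ContinuousOn g (Icc 0 1))
    (h : ∀ x ∈ Icc (0 : ℝ) 1, f x = f 0 + ∫ y in (0 : ℝ)..x, g y) {x : ℝ}
    (hx : x ∈ Icc (0 : ℝ) 1) : HasDerivWithinAt f (g x) (Icc 0 1) x := by
  have hint : IntervalIntegrable g volume 0 x :=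
    (hg.mono (by rw [uIcc_of_le hx.1]; exact Icc_subset_Icc_right hx.2)).intervalIntegrable
  have : Fact (x ∈ Icc (0 : ℝ) 1) := ⟨hx⟩
  have h1 : HasDerivWithinAt (fun u => ∫ y in (0 : ℝ)..u, g y) (g x) (Icc 0 1) x :=
    intervalIntegral.integral_hasDerivWithinAt_right hint
      (hg.stronglyMeasurableAtFilter_nhdsWithin measurableSet_Icc x) (hg x hx)
  exact (h1.const_add (f 0)).congr h (h x hx)

theorem EdgeH2.continuousOn_der (u : EdgeH2 𝕜) : ContinuousOn u.der (Icc 0 1) := by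
  have hi : IntegrableOn u.der2 (Icc 0 1) := u.memLp.integrable (by norm_num)
  have := intervalIntegral.continuousOn_primitive_interval (μ := volume) (f := u.der2)
    (a := 0) (b := 1) (by rwa [uIcc_of_le zero_le_one])
  rw [uIcc_of_le zero_le_one] at this
  exact (continuousOn_const.add this).congr u.der_eq

theorem EdgeH2.hasDerivWithinAt_val (u : EdgeH2 𝕜) {x : ℝ} (hx : x ∈ Icc (0 : ℝ) 1) :
    HasDerivWithinAt u.val (u.der x) (Icc 0 1) x :=
  hasDerivWithinAt_of_eq_primitive u.continuousOn_der u.val_eq hx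

/-- Under the integral `der2` may be replaced by the continuous function `(q - lam) * val`, so the
almost everywhere equation holds classically up to the ends. -/
theorem EdgeH2.isSol {q : ℝ → ℝ} (hq : ContinuousOn q (Icc 0 1)) {lam : ℝ} {u : EdgeH2 𝕜}
    (hu : SolvesSchrodinger q lam u) : IsSol q lam u.val u.der := by
  intro x hx
  refine ⟨u.hasDerivWithinAt_val hx, ?_⟩
  have hv : ContinuousOn u.val (Icc 0 1) := fun y hy => (u.hasDerivWithinAt_val hy).continuousWithinAt
  refine hasDerivWithinAt_of_eq_primitive
    (g := fun x => ((q x - lam : ℝ) : 𝕜) * u.val x) ?_ ?_ hx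
  · exact (RCLike.continuous_ofReal.comp_continuousOn (hq.sub continuousOn_const)).mul hv
  · intro y hy
    rw [u.der_eq y hy]
    congr 1
    apply intervalIntegral.integral_congr_ae
    have h1 := (ae_restrict_iff' measurableSet_Icc).1 hu
    filter_upwards [h1] with z hz hzy
    rw [uIoc_of_le hy.1] at hzy
    have := hz ⟨hzy.1.le, hzy.2.trans hy.2⟩
    push_cast
    linear_combination -this

/-- Functions that are twice continuously differentiable on the line define edge functions. -/
def EdgeH2.ofClassical (y z w : ℝ → 𝕜) (hw : Continuous w) (hy : ∀ x, HasDerivAt y (z x) x)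
    (hz : ∀ x, HasDerivAt z (w x) x) : EdgeH2 𝕜 where
  val := y
  der := z
  der2 := w
  memLp := by
    obtain ⟨C, hC⟩ := isCompact_Icc.exists_bound_of_continuousOn (s := Icc (0 : ℝ) 1) hw.continuousOn
    exact MemLp.of_bound hw.aestronglyMeasurable C
      ((ae_restrict_iff' measurableSet_Icc).2 (.of_forall hC))
  der_eq := fun x _ => by
    rw [intervalIntegral.integral_eq_sub_of_hasDerivAt (fun t _ => hz t)
      (hw.intervalIntegrable _ _)]
    ring
  val_eq := fun x _ => by
    have : Continuous z := continuous_iff_continuousAt.2 fun t => (hz t).continuousAt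
    rw [intervalIntegral.integral_eq_sub_of_hasDerivAt (fun t _ => hy t)
      (this.intervalIntegrable _ _)]
    ring

theorem EdgeH2.solves_ofClassical {q : ℝ → ℝ} {lam : ℝ} {y z w : ℝ → 𝕜} {hw : Continuous w}
    {hy : ∀ x, HasDerivAt y (z x) x} {hz : ∀ x, HasDerivAt z (w x) x}
    (h : ∀ x ∈ Icc (0 : ℝ) 1, w x = ((q x - lam : ℝ) : 𝕜) * y x) :
    SolvesSchrodinger q lam (EdgeH2.ofClassical y z w hw hy hz) := by
  refine (ae_restrict_iff' measurableSet_Icc).2 (.of_forall fun x hx => ?_)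
  have := h x hx
  push_cast at this
  simp only [EdgeH2.ofClassical]
  linear_combination -this

theorem eq_of_hasDerivWithinAt_zero {f : ℝ → 𝕜}
    (h : ∀ x ∈ Icc (0 : ℝ) 1, HasDerivWithinAt f 0 (Icc 0 1) x) {x : ℝ} (hx : x ∈ Icc (0 : ℝ) 1) :
    f x = f 0 :=
  constant_of_has_deriv_right_zero (fun y hy => (h y hy).continuousWithinAt)
    (fun y hy => (h y ⟨hy.1, hy.2.le⟩).mono_of_mem_nhdsWithin
      (mem_of_superset (Icc_mem_nhdsGE_of_mem hy) subset_rfl)) x hx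

theorem IsSol.continuousOn {q : ℝ → ℝ} {lam : ℝ} {y z : ℝ → 𝕜} (h : IsSol q lam y z) :
    ContinuousOn y (Icc 0 1) := fun x hx => (h x hx).1.continuousWithinAt

theorem IsSol.continuousOn_der {q : ℝ → ℝ} {lam : ℝ} {y z : ℝ → 𝕜} (h : IsSol q lam y z) :
    ContinuousOn z (Icc 0 1) := fun x hx => (h x hx).2.continuousWithinAt

theorem IsSol.hasDerivWithinAt_wronskian {q : ℝ → ℝ} {lam mu : ℝ} {y z v w : ℝ → 𝕜}
    (h : IsSol q lam y z) (h' : IsSol q mu v w) {x : ℝ} (hx : x ∈ Icc (0 : ℝ) 1) :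
    HasDerivWithinAt (fun x => y x * w x - z x * v x) (((lam - mu : ℝ) : 𝕜) * (y x * v x))
      (Icc 0 1) x := by
  refine (((h x hx).1.mul (h' x hx).2).sub ((h x hx).2.mul (h' x hx).1)).congr_deriv ?_
  push_cast
  ring

theorem IsSol.wronskian_eq {q : ℝ → ℝ} {lam : ℝ} {y z v w : ℝ → 𝕜}
    (h : IsSol q lam y z) (h' : IsSol q lam v w) :
    y 1 * w 1 - z 1 * v 1 = y 0 * w 0 - z 0 * v 0 := by
  refine eq_of_hasDerivWithinAt_zero (f := fun x => y x * w x - z x * v x) (fun x hx => ?_)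
    (right_mem_Icc.2 zero_le_one)
  simpa using h.hasDerivWithinAt_wronskian h' hx

/-- Lagrange's identity. -/
theorem IsSol.lagrange {q : ℝ → ℝ} {lam mu : ℝ} {y z v w : ℝ → ℝ}
    (h : IsSol q lam y z) (h' : IsSol q mu v w) :
    y 1 * w 1 - z 1 * v 1 - (y 0 * w 0 - z 0 * v 0) =
      (lam - mu) * ∫ x in (0 : ℝ)..1, y x * v x := by
  rw [← intervalIntegral.integral_const_mul]
  symm
  refine intervalIntegral.integral_eq_sub_of_hasDeriv_right_of_le
    (f := fun x => y x * w x - z x * v x) zero_le_one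
    ((h.continuousOn.mul h'.continuousOn_der).sub (h.continuousOn_der.mul h'.continuousOn))
    (fun x hx => ?_) ?_
  · have := h.hasDerivWithinAt_wronskian h' (Ioo_subset_Icc_self hx)
    exact (this.hasDerivAt (Icc_mem_nhds hx.1 hx.2)).hasDerivWithinAt
  · apply ContinuousOn.intervalIntegrable
    rw [uIcc_of_le zero_le_one]
    exact continuousOn_const.mul (h.continuousOn.mul h'.continuousOn)

/-- Grönwall for the first order system in `(y, z)`, whose right side is bounded by `max 1 C` times
the sup norm of the pair. -/
theorem IsSol.eq_zero {q : ℝ → ℝ} (hq : ContinuousOn q (Icc 0 1)) {lam : ℝ} {y z : ℝ → 𝕜}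
    (h : IsSol q lam y z) (h0 : y 0 = 0) (h1 : z 0 = 0) : ∀ x ∈ Icc (0 : ℝ) 1, y x = 0 := by
  obtain ⟨C, hC⟩ := isCompact_Icc.exists_bound_of_continuousOn (s := Icc (0 : ℝ) 1)
    (hq.sub (continuousOn_const (c := lam)))
  have key := eq_zero_of_abs_deriv_le_mul_abs_self_of_eq_zero_right (a := 0) (b := 1)
    (f := fun x => (y x, z x)) (f' := fun x => (z x, ((q x - lam : ℝ) : 𝕜) * y x))
    (K := max 1 C) (h.continuousOn.prodMk h.continuousOn_der)
    (fun x hx => ?_) (by simp [h0, h1]) (fun x hx => ?_)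
  · exact fun x hx => (Prod.mk.inj (key x hx)).1
  · exact ((h x ⟨hx.1, hx.2.le⟩).1.prodMk (h x ⟨hx.1, hx.2.le⟩).2).mono_of_mem_nhdsWithin
      (mem_of_superset (Icc_mem_nhdsGE_of_mem hx) subset_rfl)
  · have hc := hC x ⟨hx.1, hx.2.le⟩
    have hy : ‖y x‖ ≤ ‖(y x, z x)‖ := norm_fst_le (y x, z x)
    have hz : ‖z x‖ ≤ ‖(y x, z x)‖ := norm_snd_le (y x, z x)
    have hn := norm_nonneg (y x, z x)
    refine norm_prod_le_iff.2 ⟨?_, ?_⟩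
    · calc ‖z x‖ ≤ 1 * ‖(y x, z x)‖ := by simp
        _ ≤ _ := by gcongr; exact le_max_left _ _
    · simp only [norm_mul, RCLike.norm_ofReal]
      calc |q x - lam| * ‖y x‖ ≤ C * ‖(y x, z x)‖ := by
            gcongr
            · exact (abs_nonneg _).trans hc
            · exact hc
        _ ≤ _ := by gcongr; exact le_max_right _ _

theorem IsSol.ofReal {q : ℝ → ℝ} {lam : ℝ} {y z : ℝ → ℝ} (h : IsSol q lam y z) :
    IsSol q lam (fun x => (y x : 𝕜)) (fun x => (z x : 𝕜)) := by
  intro x hx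
  have h1 := (RCLike.ofRealCLM (K := 𝕜)).hasFDerivAt.comp_hasDerivWithinAt x (h x hx).1
  have h2 := (RCLike.ofRealCLM (K := 𝕜)).hasFDerivAt.comp_hasDerivWithinAt x (h x hx).2
  refine ⟨h1, h2.congr_deriv ?_⟩
  simp

theorem IsSol.reflect {q : ℝ → ℝ} (hsym : ∀ x ∈ Icc (0 : ℝ) 1, q x = q (1 - x)) {lam : ℝ}
    {y z : ℝ → 𝕜} (h : IsSol q lam y z) :
    IsSol q lam (fun x => y (1 - x)) (fun x => -z (1 - x)) := by
  intro x hx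
  have hx' : 1 - x ∈ Icc (0 : ℝ) 1 := ⟨by linarith [hx.2], by linarith [hx.1]⟩
  have hmaps : MapsTo (fun x : ℝ => 1 - x) (Icc 0 1) (Icc 0 1) := fun t ht =>
    ⟨by linarith [ht.2], by linarith [ht.1]⟩
  have hd : HasDerivWithinAt (fun x : ℝ => 1 - x) (-1) (Icc 0 1) x :=
    (hasDerivWithinAt_id x _).const_sub 1
  have h1 := (h _ hx').1.scomp x hd hmaps
  have h2 := ((h _ hx').2.scomp x hd hmaps).neg
  refine ⟨h1.congr_deriv (by simp), h2.congr_deriv ?_⟩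
  simp [hsym x hx]

theorem IsSol.add_smul {q : ℝ → ℝ} {lam : ℝ} {y z v w : ℝ → 𝕜}
    (h : IsSol q lam y z) (h' : IsSol q lam v w) (a b : 𝕜) :
    IsSol q lam (fun x => a * y x + b * v x) (fun x => a * z x + b * w x) := by
  intro x hx
  refine ⟨((h x hx).1.const_mul a).add ((h' x hx).1.const_mul b),
    (((h x hx).2.const_mul a).add ((h' x hx).2.const_mul b)).congr_deriv (by ring)⟩

end

/-! ### Construction of `s` by a Volterra equation, with C² dependence on the potential. -/

section

/-- Continuous functions on `[0,1]`. -/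
abbrev CI := C(Icc (0 : ℝ) 1, ℝ)

/-- The extension of a function on `[0,1]` to the line that is constant outside. -/
noncomputable def ext (u : CI) : ℝ → ℝ := IccExtend zero_le_one u

theorem continuous_ext (u : CI) : Continuous (ext u) := u.continuous.Icc_extend'

theorem ext_of_mem (u : CI) {x : ℝ} (hx : x ∈ Icc (0 : ℝ) 1) : ext u x = u ⟨x, hx⟩ :=
  IccExtend_of_mem _ _ hx

theorem ext_coe (u : CI) (x : Icc (0 : ℝ) 1) : ext u x = u x := IccExtend_val _ _ x

theorem abs_ext_le (u : CI) (x : ℝ) : |ext u x| ≤ ‖u‖ := u.norm_coe_le_norm _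

/-- The primitive that vanishes at `0`, as an operator on continuous functions. -/
noncomputable def primitive : CI →L[ℝ] CI :=
  LinearMap.mkContinuous
    { toFun := fun u => ⟨fun x => ∫ y in (0 : ℝ)..x, ext u y,
        (intervalIntegral.continuous_primitive
          (fun a b => (continuous_ext u).intervalIntegrable a b) 0).comp continuous_subtype_val⟩
      map_add' := fun u v => by
        ext x
        exact intervalIntegral.integral_add ((continuous_ext u).intervalIntegrable _ _)
          ((continuous_ext v).intervalIntegrable _ _)
      map_smul' := fun c u => by
        ext x
        exact intervalIntegral.integral_const_mul c (ext u) } 1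
    (fun u => by
      rw [one_mul]
      refine (ContinuousMap.norm_le _ (norm_nonneg _)).2 fun x => ?_
      refine (intervalIntegral.norm_integral_le_of_norm_le_const (C := ‖u‖)
        fun y _ => abs_ext_le u y).trans ?_
      rw [sub_zero, abs_of_nonneg x.2.1]
      exact mul_le_of_le_one_right (norm_nonneg _) x.2.2)

theorem primitive_apply (u : CI) (x : Icc (0 : ℝ) 1) :
    primitive u x = ∫ y in (0 : ℝ)..x, ext u y := rfl

theorem abs_primitive_le {u : CI} {B : ℝ} {n : ℕ}
    (h : ∀ x : Icc (0 : ℝ) 1, |u x| ≤ B * ((x : ℝ) ^ n / n.factorial)) (x : Icc (0 : ℝ) 1) :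
    |primitive u x| ≤ B * ((x : ℝ) ^ (n + 1) / (n + 1).factorial) := by
  have hint : ∫ y in (0 : ℝ)..x, B * (y ^ n / n.factorial) =
      B * ((x : ℝ) ^ (n + 1) / (n + 1).factorial) := by
    rw [intervalIntegral.integral_const_mul, intervalIntegral.integral_div, integral_pow,
      Nat.factorial_succ]
    push_cast
    field_simp
    simp
  rw [primitive_apply, ← hint, ← Real.norm_eq_abs]
  refine intervalIntegral.norm_integral_le_of_norm_le x.2.1 ?_
    (Continuous.intervalIntegrable (by fun_prop) _ _)
  refine .of_forall fun y hy => ?_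
  have hy' : y ∈ Icc (0 : ℝ) 1 := ⟨hy.1.le, hy.2.trans x.2.2⟩
  rw [ext_of_mem u hy']
  exact h ⟨y, hy'⟩

/-- The Volterra operator `u ↦ ∫∫ p u`, depending linearly on `p`. -/
noncomputable def volterra : CI →L[ℝ] (CI →L[ℝ] CI) :=
  (ContinuousLinearMap.compL ℝ CI CI CI (primitive.comp primitive)).comp
    (ContinuousLinearMap.mul ℝ CI)

theorem volterra_apply (p u : CI) : volterra p u = primitive (primitive (p * u)) := rfl

/-- Each application integrates twice, which raises `x ^ n / n!` by two steps; the factorial makes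
high powers small for any `p`. -/
theorem abs_volterra_pow_le (p u : CI) (n : ℕ) (x : Icc (0 : ℝ) 1) :
    |(volterra p ^ n) u x| ≤ ‖p‖ ^ n * ‖u‖ * ((x : ℝ) ^ (2 * n) / (2 * n).factorial) := by
  induction n generalizing x with
  | zero => simpa using u.norm_coe_le_norm x
  | succ n ih =>
    rw [pow_succ']
    refine abs_primitive_le (n := 2 * n + 1) (abs_primitive_le fun y => ?_) x
    change |p y * (volterra p ^ n) u y| ≤ _
    rw [abs_mul]
    calc |p y| * |(volterra p ^ n) u y| ≤
        ‖p‖ * (‖p‖ ^ n * ‖u‖ * ((y : ℝ) ^ (2 * n) / (2 * n).factorial)) := by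
          gcongr
          · exact p.norm_coe_le_norm y
          · exact ih y
      _ = _ := by ring

/-- Some power `V ^ n` has norm below `1`, so `1 - V ^ n` is invertible; it is the product of `1 -
V` and a geometric sum commuting with it, so `1 - V` is invertible as well. -/
theorem isUnit_one_sub_volterra (p : CI) : IsUnit (1 - volterra p) := by
  obtain ⟨n, hn⟩ := ((FloorSemiring.tendsto_pow_div_factorial_atTop ‖p‖).eventually
    (gt_mem_nhds one_pos)).exists
  have hlt : ‖volterra p ^ n‖ < 1 := by
    refine lt_of_le_of_lt (ContinuousLinearMap.opNorm_le_bound _ (by positivity) fun u => ?_) hn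
    refine (ContinuousMap.norm_le _ (by positivity)).2 fun x => ?_
    refine (abs_volterra_pow_le p u n x).trans ?_
    calc ‖p‖ ^ n * ‖u‖ * ((x : ℝ) ^ (2 * n) / (2 * n).factorial)
        ≤ ‖p‖ ^ n * ‖u‖ * (1 / n.factorial) := by
          gcongr
          · exact pow_le_one₀ x.2.1 x.2.2
          · omega
      _ = _ := by ring
  have h1 : IsUnit (1 - volterra p ^ n) := (Units.oneSub (volterra p ^ n) hlt).isUnit
  have h2 : (1 - volterra p) * ∑ i ∈ Finset.range n, volterra p ^ i = 1 - volterra p ^ n :=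
    mul_neg_geom_sum _ _
  have hc : Commute (1 - volterra p) (∑ i ∈ Finset.range n, volterra p ^ i) :=
    Commute.sum_right _ _ _ fun i _ =>
      (Commute.one_left _).sub_left ((Commute.refl _).pow_right i)
  exact (hc.isUnit_mul_iff.1 (h2 ▸ h1)).1

/-- The solution of `u = x + ∫∫ p u`. -/
noncomputable def volterraSol (p : CI) : CI :=
  Ring.inverse (1 - volterra p) ⟨Subtype.val, continuous_subtype_val⟩

theorem volterraSol_eq (p : CI) (x : Icc (0 : ℝ) 1) :
    volterraSol p x = x + primitive (primitive (p * volterraSol p)) x := by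
  have h := congrArg (fun T : CI →L[ℝ] CI => T ⟨Subtype.val, continuous_subtype_val⟩)
    (Ring.mul_inverse_cancel _ (isUnit_one_sub_volterra p))
  have h' := congrArg (fun u : CI => u x) h
  change volterraSol p x - volterra p (volterraSol p) x = x at h'
  rw [volterra_apply] at h'
  linarith

/-- Inversion is smooth at units. This is the source of all regularity in the energy; two
derivatives are what the quadratic error at a cone needs. -/
theorem contDiff_inverse_one_sub_volterra :
    ContDiff ℝ 2 (fun p => Ring.inverse (1 - volterra p)) := by
  refine contDiff_iff_contDiffAt.2 fun p => ?_
  obtain ⟨U, hU⟩ := isUnit_one_sub_volterra p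
  have h1 : ContDiffAt ℝ 2 (Ring.inverse : (CI →L[ℝ] CI) → (CI →L[ℝ] CI)) (1 - volterra p) := by
    have h := contDiffAt_ringInverse ℝ (n := 2) (R := CI →L[ℝ] CI) U
    rw [hU] at h
    exact h
  have h2 : ContDiffAt ℝ 2 (fun p => 1 - volterra p) p := by fun_prop
  exact h1.comp p h2

theorem contDiff_volterraSol : ContDiff ℝ 2 volterraSol :=
  contDiff_inverse_one_sub_volterra.clm_apply contDiff_const

/-- The second derivative of the solution with Cauchy data `0, 1`, continuous on the line. -/
noncomputable def sinDer2 (p : CI) (x : ℝ) : ℝ := ext (p * volterraSol p) x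

/-- The derivative of the solution with Cauchy data `0, 1`. -/
noncomputable def sinDer (p : CI) (x : ℝ) : ℝ := 1 + ∫ y in (0 : ℝ)..x, sinDer2 p y

/-- The solution of `y'' = p y` with Cauchy data `0, 1`. -/
noncomputable def sinVal (p : CI) (x : ℝ) : ℝ := ∫ y in (0 : ℝ)..x, sinDer p y

theorem continuous_sinDer2 (p : CI) : Continuous (sinDer2 p) := continuous_ext _

theorem hasDerivAt_sinDer (p : CI) (x : ℝ) : HasDerivAt (sinDer p) (sinDer2 p x) x :=
  ((continuous_sinDer2 p).integral_hasStrictDerivAt 0 x).hasDerivAt.const_add 1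

theorem continuous_sinDer (p : CI) : Continuous (sinDer p) :=
  continuous_iff_continuousAt.2 fun x => (hasDerivAt_sinDer p x).continuousAt

theorem hasDerivAt_sinVal (p : CI) (x : ℝ) : HasDerivAt (sinVal p) (sinDer p x) x :=
  ((continuous_sinDer p).integral_hasStrictDerivAt 0 x).hasDerivAt

theorem sinVal_zero (p : CI) : sinVal p 0 = 0 := by simp [sinVal]

theorem sinDer_zero (p : CI) : sinDer p 0 = 1 := by simp [sinDer]

theorem sinDer_coe (p : CI) (x : Icc (0 : ℝ) 1) :
    sinDer p x = 1 + primitive (p * volterraSol p) x := rfl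

/-- Closes the loop: `sinVal` is a double integral over the whole line, so its derivatives are
two-sided, and the fixed point equation identifies it with `volterraSol` on `[0,1]`. -/
theorem sinVal_coe (p : CI) (x : Icc (0 : ℝ) 1) : sinVal p x = volterraSol p x := by
  rw [volterraSol_eq, primitive_apply, sinVal]
  have : ∀ y ∈ uIcc (0 : ℝ) x, sinDer p y = 1 + ext (primitive (p * volterraSol p)) y := by
    intro y hy
    rw [uIcc_of_le x.2.1] at hy
    have hy' : y ∈ Icc (0 : ℝ) 1 := ⟨hy.1, hy.2.trans x.2.2⟩
    rw [ext_of_mem _ hy']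
    exact sinDer_coe p ⟨y, hy'⟩
  rw [intervalIntegral.integral_congr this, intervalIntegral.integral_add
    (by simp) ((continuous_ext _).intervalIntegrable _ _)]
  simp

theorem sinDer2_of_mem (p : CI) {x : ℝ} (hx : x ∈ Icc (0 : ℝ) 1) :
    sinDer2 p x = p ⟨x, hx⟩ * sinVal p x := by
  rw [sinDer2, ext_of_mem _ hx, ContinuousMap.mul_apply, ← sinVal_coe]

theorem contDiff_sinVal (x : Icc (0 : ℝ) 1) : ContDiff ℝ 2 (fun p => sinVal p x) := by
  simp_rw [sinVal_coe]
  exact (ContinuousMap.evalCLM ℝ x).contDiff.comp contDiff_volterraSol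

theorem contDiff_sinDer (x : Icc (0 : ℝ) 1) : ContDiff ℝ 2 (fun p => sinDer p x) := by
  simp_rw [sinDer_coe]
  have h : ContDiff ℝ 2 (fun p : CI => p * volterraSol p) := contDiff_id.mul contDiff_volterraSol
  have h' : ContDiff ℝ 2 (fun p : CI => ContinuousMap.evalCLM ℝ x (primitive (p * volterraSol p))) :=
    ((ContinuousMap.evalCLM ℝ x : CI →L[ℝ] ℝ).comp primitive).contDiff.comp h
  exact contDiff_const.add h'

end

/-! ### End data of `s` as functions of the energy, and the Dirichlet spectrum. -/

section

variable {𝕜 : Type} [RCLike 𝕜]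

/-- The potential shifted by the energy. -/
noncomputable def shifted (Q : CI) (lam : ℝ) : CI := Q - ContinuousMap.const _ lam

/-- The value at `1` of the solution with Cauchy data `0, 1`. -/
noncomputable def sinEnd (Q : CI) (lam : ℝ) : ℝ := sinVal (shifted Q lam) 1

/-- The derivative at `1` of the solution with Cauchy data `0, 1`. -/
noncomputable def sinDerEnd (Q : CI) (lam : ℝ) : ℝ := sinDer (shifted Q lam) 1

theorem contDiff_shifted (Q : CI) : ContDiff ℝ 2 (shifted Q) := by
  have h : shifted Q = fun lam => Q - lam • (1 : CI) := by
    ext lam x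
    simp [shifted]
  rw [h]
  fun_prop

theorem contDiff_sinEnd (Q : CI) : ContDiff ℝ 2 (sinEnd Q) :=
  (contDiff_sinVal 1).comp (contDiff_shifted Q)

theorem contDiff_sinDerEnd (Q : CI) : ContDiff ℝ 2 (sinDerEnd Q) :=
  (contDiff_sinDer 1).comp (contDiff_shifted Q)

variable {q : ℝ → ℝ} {Q : CI} {lam : ℝ}

theorem isSol_sin (hQ : ∀ x, Q x = q x) (lam : ℝ) :
    IsSol q lam (sinVal (shifted Q lam)) (sinDer (shifted Q lam)) := by
  intro x hx
  refine ⟨(hasDerivAt_sinVal _ x).hasDerivWithinAt,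
    (hasDerivAt_sinDer _ x).hasDerivWithinAt.congr_deriv ?_⟩
  rw [sinDer2_of_mem _ hx]
  simp [shifted, hQ]

/-- The edge function `α s(x) + β s(1 - x)`, where `s` has Cauchy data `0, 1` at `0`. -/
noncomputable def solEdge (p : CI) (α β : 𝕜) : EdgeH2 𝕜 :=
  EdgeH2.ofClassical (fun x => α * (sinVal p x : 𝕜) + β * (sinVal p (1 - x) : 𝕜))
    (fun x => α * (sinDer p x : 𝕜) - β * (sinDer p (1 - x) : 𝕜))
    (fun x => α * (sinDer2 p x : 𝕜) + β * (sinDer2 p (1 - x) : 𝕜))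
    (by
      have h := continuous_sinDer2 p
      have h1 : Continuous fun x => (sinDer2 p x : 𝕜) := RCLike.continuous_ofReal.comp h
      exact (continuous_const.mul h1).add (continuous_const.mul (h1.comp (by fun_prop))))
    (fun x => by
      have h := (RCLike.ofRealCLM (K := 𝕜)).hasFDerivAt.comp_hasDerivAt x (hasDerivAt_sinVal p x)
      have h' := (RCLike.ofRealCLM (K := 𝕜)).hasFDerivAt.comp_hasDerivAt x
        ((hasDerivAt_sinVal p (1 - x)).scomp x ((hasDerivAt_id x).const_sub 1))
      exact ((h.const_mul α).add (h'.const_mul β)).congr_deriv (by simp; ring))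
    (fun x => by
      have h := (RCLike.ofRealCLM (K := 𝕜)).hasFDerivAt.comp_hasDerivAt x (hasDerivAt_sinDer p x)
      have h' := (RCLike.ofRealCLM (K := 𝕜)).hasFDerivAt.comp_hasDerivAt x
        ((hasDerivAt_sinDer p (1 - x)).scomp x ((hasDerivAt_id x).const_sub 1))
      exact ((h.const_mul α).sub (h'.const_mul β)).congr_deriv (by simp))

theorem solves_solEdge (hQ : ∀ x, Q x = q x)
    (hsym : ∀ x ∈ Icc (0 : ℝ) 1, q x = q (1 - x)) (α β : 𝕜) :
    SolvesSchrodinger q lam (solEdge (shifted Q lam) α β) := by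
  refine EdgeH2.solves_ofClassical fun x hx => ?_
  have hx' : 1 - x ∈ Icc (0 : ℝ) 1 := ⟨by linarith [hx.2], by linarith [hx.1]⟩
  rw [sinDer2_of_mem _ hx, sinDer2_of_mem _ hx']
  have h := hsym x hx
  simp only [shifted, ContinuousMap.sub_apply, hQ, ContinuousMap.const_apply, ← h]
  push_cast
  ring

theorem solEdge_val_zero (α β : 𝕜) :
    (solEdge (shifted Q lam) α β).val 0 = β * (sinEnd Q lam : 𝕜) := by
  simp [solEdge, EdgeH2.ofClassical, sinVal_zero, sinEnd]

theorem solEdge_val_one (α β : 𝕜) :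
    (solEdge (shifted Q lam) α β).val 1 = α * (sinEnd Q lam : 𝕜) := by
  simp [solEdge, EdgeH2.ofClassical, sinVal_zero, sinEnd]

theorem solEdge_der_zero (α β : 𝕜) :
    (solEdge (shifted Q lam) α β).der 0 = α - β * (sinDerEnd Q lam : 𝕜) := by
  simp [solEdge, EdgeH2.ofClassical, sinDer_zero, sinDerEnd]

theorem solEdge_der_one (α β : 𝕜) :
    (solEdge (shifted Q lam) α β).der 1 = α * (sinDerEnd Q lam : 𝕜) - β := by
  simp [solEdge, EdgeH2.ofClassical, sinDer_zero, sinDerEnd]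

/-- Constancy of the Wronskian with `s`. Without division by `s(1)` the identity remains valid at
Dirichlet eigenvalues. -/
theorem IsSol.der_one (hQ : ∀ x, Q x = q x) {y z : ℝ → 𝕜} (h : IsSol q lam y z) :
    z 1 * (sinEnd Q lam : 𝕜) = y 1 * (sinDerEnd Q lam : 𝕜) - y 0 := by
  have := h.wronskian_eq (isSol_sin hQ lam).ofReal
  simp only [sinVal_zero, sinDer_zero, RCLike.ofReal_zero, RCLike.ofReal_one] at this
  simp only [sinEnd, sinDerEnd]
  linear_combination -this

theorem IsSol.der_zero (hQ : ∀ x, Q x = q x)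
    (hsym : ∀ x ∈ Icc (0 : ℝ) 1, q x = q (1 - x)) {y z : ℝ → 𝕜} (h : IsSol q lam y z) :
    z 0 * (sinEnd Q lam : 𝕜) = y 1 - y 0 * (sinDerEnd Q lam : 𝕜) := by
  have := (h.reflect hsym).der_one hQ
  simp only [sub_self, sub_zero] at this
  linear_combination -this

theorem exists_sinVal_ne_zero (p : CI) : ∃ x ∈ Icc (0 : ℝ) 1, sinVal p x ≠ 0 := by
  by_contra! h
  have h1 : HasDerivWithinAt (sinVal p) 0 (Icc 0 1) 0 :=
    (hasDerivWithinAt_const 0 _ (0 : ℝ)).congr h (h 0 (by simp))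
  have h2 := (hasDerivAt_sinVal p 0).hasDerivWithinAt (s := Icc 0 1)
  have := (uniqueDiffOn_Icc_zero_one 0 (by simp)).eq_deriv _ h1 h2
  rw [sinDer_zero] at this
  exact zero_ne_one this

theorem sinEnd_ne_zero_iff (hq : ContinuousOn q (Icc 0 1)) (hQ : ∀ x, Q x = q x)
    (hsym : ∀ x ∈ Icc (0 : ℝ) 1, q x = q (1 - x)) :
    sinEnd Q lam ≠ 0 ↔ lam ∉ dirichletSpectrum q := by
  rw [not_iff_not]
  constructor
  · intro h
    obtain ⟨x, hx, hx0⟩ := exists_sinVal_ne_zero (shifted Q lam)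
    refine ⟨solEdge (shifted Q lam) 1 0, solves_solEdge hQ hsym _ _, ?_, ?_, x, hx, ?_⟩
    · simp [solEdge_val_zero]
    · simp [solEdge_val_one, h]
    · simpa [solEdge, EdgeH2.ofClassical] using hx0
  · rintro ⟨u, hu, h0, h1, x, hx, hx0⟩
    by_contra hS
    have hs := EdgeH2.isSol hq hu
    have := hs.der_zero hQ hsym
    rw [h0, h1] at this
    simp only [zero_mul, sub_zero, mul_eq_zero] at this
    exact hx0 (hs.eq_zero hq h0 (this.resolve_right (by simpa using hS)) x hx)

theorem IsSol.eq_zero_of_ends (hq : ContinuousOn q (Icc 0 1)) (hQ : ∀ x, Q x = q x)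
    (hsym : ∀ x ∈ Icc (0 : ℝ) 1, q x = q (1 - x)) {y z : ℝ → 𝕜} (h : IsSol q lam y z)
    (hS : sinEnd Q lam ≠ 0) (h0 : y 0 = 0) (h1 : y 1 = 0) : ∀ x ∈ Icc (0 : ℝ) 1, y x = 0 := by
  have := h.der_zero hQ hsym
  rw [h0, h1] at this
  simp only [zero_mul, sub_zero, mul_eq_zero] at this
  exact h.eq_zero hq h0 (this.resolve_right (by simpa using hS))

/-- The solution `s(1 - x) + s'(1) s(x)` has zero Cauchy data at `0` when `s(1) = 0`, so it
vanishes; its derivative at `1` is `s'(1)² - 1`. -/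
theorem sinDerEnd_sq (hq : ContinuousOn q (Icc 0 1)) (hQ : ∀ x, Q x = q x)
    (hsym : ∀ x ∈ Icc (0 : ℝ) 1, q x = q (1 - x)) (hS : sinEnd Q lam = 0) :
    sinDerEnd Q lam ^ 2 = 1 := by
  have hs := isSol_sin hQ lam
  have h := (hs.reflect hsym).add_smul hs 1 (sinDerEnd Q lam)
  have hz := h.eq_zero hq (by
      rw [sinEnd] at hS
      simp [sinVal_zero, hS])
    (by simp [sinDer_zero, sinDerEnd])
  have h1 := (h 1 (by simp)).1
  have h2 : HasDerivWithinAt (fun x => 1 * sinVal (shifted Q lam) (1 - x) +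
      sinDerEnd Q lam * sinVal (shifted Q lam) x) 0 (Icc 0 1) 1 :=
    (hasDerivWithinAt_const 1 _ (0 : ℝ)).congr hz (hz 1 (by simp))
  have := (uniqueDiffOn_Icc_zero_one 1 (by simp)).eq_deriv _ h1 h2
  simp only [sub_self, sinDer_zero] at this
  rw [sinDerEnd] at this ⊢
  linear_combination this

/-- Away from the Dirichlet spectrum the bands are described by the solution with Cauchy data
`0, 1`. -/
theorem mem_band_iff {G : Bilayer} (hq : ContinuousOn G.q (Icc 0 1)) (hQ : ∀ x, Q x = G.q x)
    (hsym : ∀ x ∈ Icc (0 : ℝ) 1, G.q x = G.q (1 - x)) {ε : ℝ} {θ : Momentum} :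
    (θ, lam) ∈ band G ε ↔ sinEnd Q lam ≠ 0 ∧ ∃ σ ∈ ({1, -1} : Set ℝ),
      sinDerEnd Q lam = root ε σ (G.δa * sinEnd Q lam) (G.δb * sinEnd Q lam) G.t (F θ) := by
  have hD := sinEnd_ne_zero_iff (lam := lam) hq hQ hsym
  constructor
  · rintro ⟨h, φ, ⟨hφ, h0, h1⟩, σ, hσ, he⟩
    have hs := EdgeH2.isSol hq hφ
    have hS := hD.2 h
    have e0 := hs.der_zero hQ hsym
    have e1 := hs.der_one hQ
    simp only [h0, h1, RCLike.ofReal_real_eq_id, id] at e0 e1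
    -- Here `φ = s / s(1)`, so `η` is just `s'(1)` and dividing by `φ'(0)` is multiplying by `s(1)`.
    have hd0 : φ.der 0 = (sinEnd Q lam)⁻¹ := by
      field_simp
      linarith
    have hd1 : φ.der 1 = sinDerEnd Q lam / sinEnd Q lam := by
      field_simp
      linarith
    refine ⟨hS, σ, hσ, ?_⟩
    simp only [hd0, hd1, div_inv_eq_mul] at he
    rwa [div_mul_cancel₀ _ hS] at he
  · rintro ⟨hS, σ, hσ, he⟩
    refine ⟨hD.1 hS, solEdge (shifted Q lam) (sinEnd Q lam)⁻¹ 0,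
      ⟨solves_solEdge hQ hsym _ _, ?_, ?_⟩, σ, hσ, ?_⟩
    · simp [solEdge_val_zero]
    · simp [solEdge_val_one, hS]
    · simp only [solEdge_der_zero, solEdge_der_one, RCLike.ofReal_real_eq_id, id, zero_mul,
        sub_zero, div_inv_eq_mul]
      rwa [mul_right_comm, inv_mul_cancel₀ hS, one_mul]

end

/-! ### Reduction of the eigenvalue problem to the vertex values. -/

section

open scoped ComplexConjugate

theorem norm_phase (θ : Momentum) (j : Fin 3) : ‖phase θ j‖ = 1 := by
  fin_cases j <;> simp [phase, mul_comm Complex.I, Complex.norm_exp_ofReal_mul_I]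

theorem conj_phase_mul (θ : Momentum) (j : Fin 3) : conj (phase θ j) * phase θ j = 1 := by
  rw [Complex.conj_mul', norm_phase]
  simp

variable {Q : CI} {lam : ℝ} {G : Bilayer} {θ : Momentum}

/-- The vertex equations of an eigenfunction, multiplied by `s(1)`. -/
theorem InDomain.vertex_equations {u : Edge → EdgeH2 ℂ} (ht : G.t ≠ 0)
    (hq : ContinuousOn G.q (Icc 0 1)) (hQ : ∀ x, Q x = G.q x)
    (hsym : ∀ x ∈ Icc (0 : ℝ) 1, G.q x = G.q (1 - x)) (hu : InDomain G θ u)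
    (hs : ∀ e, SolvesSchrodinger G.q lam (u e)) (k : Fin 2) :
    conj (F θ) * (u (.a k 0)).val 1 + (G.t : ℂ) ^ 2 * (u (.a k.rev 0)).val 1 =
      ((3 + G.t ^ 2) * sinDerEnd Q lam + G.δa * sinEnd Q lam : ℝ) * (u (.a k 0)).val 0 ∧
    F θ * (u (.a k 0)).val 0 + (G.t : ℂ) ^ 2 * (u (.a k.rev 0)).val 0 =
      ((3 + G.t ^ 2) * sinDerEnd Q lam + G.δb * sinEnd Q lam : ℝ) * (u (.a k 0)).val 1 := by
  have htc : (G.t : ℂ) ≠ 0 := by exact_mod_cast ht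
  have d0 := fun e => (EdgeH2.isSol hq (hs e)).der_zero hQ hsym
  have d1 := fun e => (EdgeH2.isSol hq (hs e)).der_one hQ
  have v1 : ∀ k j, (u (.a k j)).val 1 = conj (phase θ j) * (u (.a k 0)).val 1 := fun k j => by
    rw [← hu.cont_B k j, ← mul_assoc, conj_phase_mul, one_mul]
  have f0 : ∀ k, (u (.f k)).val 0 = G.t * (u (.a k 0)).val 0 := fun k => by
    rw [← hu.weighted_A k]
    field_simp
  have f1 : ∀ k : Fin 2, (u (.f k)).val 1 = G.t * (u (.a k.rev 0)).val 1 := fun k => by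
    rw [← hu.weighted_B k.rev, Fin.rev_rev]
    field_simp
  have hA := hu.flow_A k
  have hB := hu.flow_B k
  have c0 := hu.cont_A k
  have p := conj_phase_mul θ
  have da0 := fun j => d0 (.a k j)
  have da1 := fun j => d1 (.a k j)
  have df0 := d0 (.f k)
  have df1 := d1 (.f k.rev)
  simp only [f0, f1, Fin.rev_rev] at df0 df1
  have a0 : ∀ j, (u (.a k j)).der 0 * (sinEnd Q lam : ℂ) =
      conj (phase θ j) * (u (.a k 0)).val 1 - (u (.a k 0)).val 0 * sinDerEnd Q lam := fun j => by
    have := da0 j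
    rwa [v1, c0] at this
  have a1 : ∀ j, phase θ j * (u (.a k j)).der 1 * (sinEnd Q lam : ℂ) =
      (u (.a k 0)).val 1 * sinDerEnd Q lam - phase θ j * (u (.a k 0)).val 0 := fun j => by
    have := da1 j
    rw [v1, c0] at this
    have hp := p j
    change (u (.a k j)).der 1 * (sinEnd Q lam : ℂ) = _ * (sinDerEnd Q lam : ℂ) - _ at this
    linear_combination phase θ j * this + (u (.a k 0)).val 1 * sinDerEnd Q lam * hp
  change _ * (sinEnd Q lam : ℂ) = _ - _ * (sinDerEnd Q lam : ℂ) at df0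
  change _ * (sinEnd Q lam : ℂ) = _ * (sinDerEnd Q lam : ℂ) - _ at df1
  simp only [F, Fin.sum_univ_three, map_add] at hA hB ⊢
  push_cast
  constructor
  · linear_combination (sinEnd Q lam : ℂ) * hA - a0 0 - a0 1 - a0 2 - (G.t : ℂ) * df0
  · linear_combination (sinEnd Q lam : ℂ) * hB + a1 0 + a1 1 + a1 2 + (G.t : ℂ) * df1

/-- Solutions of the vertex equations extend to eigenfunctions. -/
theorem mem_dispersion_of_vertex_equations (ht : G.t ≠ 0) (hQ : ∀ x, Q x = G.q x)
    (hsym : ∀ x ∈ Icc (0 : ℝ) 1, G.q x = G.q (1 - x)) (hS : sinEnd Q lam ≠ 0) {A B : Fin 2 → ℂ}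
    (hAB : A 0 ≠ 0 ∨ B 0 ≠ 0)
    (hA : ∀ k : Fin 2, conj (F θ) * B k + (G.t : ℂ) ^ 2 * B k.rev =
      ((3 + G.t ^ 2) * sinDerEnd Q lam + G.δa * sinEnd Q lam : ℝ) * A k)
    (hB : ∀ k : Fin 2, F θ * A k + (G.t : ℂ) ^ 2 * A k.rev =
      ((3 + G.t ^ 2) * sinDerEnd Q lam + G.δb * sinEnd Q lam : ℝ) * B k) :
    (θ, lam) ∈ dispersion G := by
  have htc : (G.t : ℂ) ≠ 0 := by exact_mod_cast ht
  have hSc : (sinEnd Q lam : ℂ) ≠ 0 := by exact_mod_cast hS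
  have p := conj_phase_mul θ
  have p0 : phase θ 0 = 1 := rfl
  have v0 := fun α β : ℂ => solEdge_val_zero (Q := Q) (lam := lam) α β
  have v1 := fun α β : ℂ => solEdge_val_one (Q := Q) (lam := lam) α β
  have w0 := fun α β : ℂ => solEdge_der_zero (Q := Q) (lam := lam) α β
  have w1 := fun α β : ℂ => solEdge_der_one (Q := Q) (lam := lam) α β
  simp only [Complex.coe_algebraMap] at v0 v1 w0 w1
  -- The coefficients are the prescribed values at `1` and at `0`, divided by `s(1)`; the remaining
  -- flow conditions are the vertex equations.
  refine ⟨fun e => match e with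
    | .a k j => solEdge (shifted Q lam) (conj (phase θ j) * B k / sinEnd Q lam)
        (A k / sinEnd Q lam)
    | .f k => solEdge (shifted Q lam) (G.t * B k.rev / sinEnd Q lam)
        (G.t * A k / sinEnd Q lam), ⟨?_, ?_, ?_, ?_, ?_, ?_⟩, ?_, ?_⟩
  · intro k j
    simp only [v0]
  · intro k j
    simp only [v1, p0, map_one, one_mul]
    field_simp
    linear_combination B k * p j
  · intro k
    simp only [v0]
    field_simp
  · intro k
    simp only [v1, p0, map_one, one_mul, Fin.rev_rev]
    field_simp
  · intro k
    have := hA k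
    simp only [v0, w0, Fin.sum_univ_three, F, map_add] at this ⊢
    push_cast at this
    field_simp
    linear_combination this
  · intro k
    have := hB k
    have h1 := p 1
    have h2 := p 2
    simp only [v1, w1, Fin.sum_univ_three, F, p0, map_one, Fin.rev_rev] at this ⊢
    push_cast at this
    field_simp
    linear_combination this - B k * sinDerEnd Q lam * (h1 + h2)
  · rintro (⟨k, j⟩ | k)
    · exact solves_solEdge hQ hsym _ _
    · exact solves_solEdge hQ hsym _ _
  · rcases hAB with h | h
    · refine ⟨.a 0 0, 0, by simp, ?_⟩
      simp only [v0]
      field_simp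
      exact h
    · refine ⟨.a 0 0, 1, by simp, ?_⟩
      simp only [v1, p0, map_one, one_mul]
      field_simp
      exact h

/-- The product of the two vertex symbols. -/
noncomputable def discr (G : Bilayer) (Q : CI) (lam : ℝ) : ℝ :=
  ((3 + G.t ^ 2) * sinDerEnd Q lam + G.δa * sinEnd Q lam) *
    ((3 + G.t ^ 2) * sinDerEnd Q lam + G.δb * sinEnd Q lam)

theorem eq_zero_of_secular {a b : ℝ} {z A B : ℂ} (h1 : conj z * B = a * A) (h2 : z * A = b * B)
    (h : a * b ≠ ‖z‖ ^ 2) : A = 0 ∧ B = 0 := by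
  have hz := Complex.conj_mul' z
  have hne : ((a : ℂ) * b - (‖z‖ : ℂ) ^ 2) ≠ 0 := by
    rw [sub_ne_zero]
    exact_mod_cast h
  constructor
  · refine (mul_eq_zero.1 ?_).resolve_left hne
    linear_combination -(b : ℂ) * h1 - conj z * h2 + A * hz
  · refine (mul_eq_zero.1 ?_).resolve_left hne
    linear_combination -(a : ℂ) * h2 - z * h1 + B * hz

/-- The kernel vector `(conj z, a)` of the singular system serves unless it is zero; then the first
column of the system vanishes. -/
theorem exists_secular {a b : ℝ} {z : ℂ} (h : a * b = ‖z‖ ^ 2) :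
    ∃ A B : ℂ, (A ≠ 0 ∨ B ≠ 0) ∧ conj z * B = a * A ∧ z * A = b * B := by
  by_cases h0 : conj z ≠ 0 ∨ (a : ℂ) ≠ 0
  · refine ⟨conj z, a, h0, mul_comm _ _, ?_⟩
    rw [mul_comm, Complex.conj_mul', ← Complex.ofReal_mul, mul_comm b, h]
    push_cast
    rfl
  · push Not at h0
    have hz : z = 0 := by simpa using h0.1
    exact ⟨1, 0, by simp, by simp [h0.2], by simp [hz]⟩

/-- The vertex equations commute with exchanging the layers: differences of the layer values satisfy
the system with `F - t²`, sums the one with `F + t²`. Vanishing vertex values force an eigenfunction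
to vanish, since `s(1) ≠ 0`. -/
theorem mem_dispersion_iff (ht : G.t ≠ 0) (hq : ContinuousOn G.q (Icc 0 1))
    (hQ : ∀ x, Q x = G.q x) (hsym : ∀ x ∈ Icc (0 : ℝ) 1, G.q x = G.q (1 - x))
    (hS : sinEnd Q lam ≠ 0) :
    (θ, lam) ∈ dispersion G ↔ ∃ σ ∈ ({1, -1} : Set ℝ),
      discr G Q lam = ‖F θ - ((σ * G.t ^ 2 : ℝ) : ℂ)‖ ^ 2 := by
  constructor
  · rintro ⟨u, hu, hs, e, x, hx, hne⟩
    by_contra! hcon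
    have hp := hcon 1 (by simp)
    have hm := hcon (-1) (by simp)
    have h0 := hu.vertex_equations ht hq hQ hsym hs 0
    have h1 := hu.vertex_equations ht hq hQ hsym hs 1
    have r0 : (0 : Fin 2).rev = 1 := rfl
    have r1 : (1 : Fin 2).rev = 0 := rfl
    rw [r0] at h0
    rw [r1] at h1
    obtain ⟨e1, e2⟩ := eq_zero_of_secular (A := (u (.a 0 0)).val 0 - (u (.a 1 0)).val 0)
      (B := (u (.a 0 0)).val 1 - (u (.a 1 0)).val 1)
      (by
        push_cast at h0 h1 ⊢
        simp only [map_sub, map_pow, Complex.conj_ofReal, one_mul]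
        linear_combination h0.1 - h1.1)
      (by
        push_cast at h0 h1 ⊢
        linear_combination h0.2 - h1.2) hp
    obtain ⟨e3, e4⟩ := eq_zero_of_secular (A := (u (.a 0 0)).val 0 + (u (.a 1 0)).val 0)
      (B := (u (.a 0 0)).val 1 + (u (.a 1 0)).val 1)
      (by
        push_cast at h0 h1 ⊢
        simp only [map_sub, map_mul, map_pow, Complex.conj_ofReal, map_one, map_neg]
        linear_combination h0.1 + h1.1)
      (by
        push_cast at h0 h1 ⊢
        linear_combination h0.2 + h1.2) hm
    have z0 : ∀ k, (u (.a k 0)).val 0 = 0 := by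
      intro k
      fin_cases k
      · change (u (.a 0 0)).val 0 = 0
        linear_combination (e1 + e3) / 2
      · change (u (.a 1 0)).val 0 = 0
        linear_combination (e3 - e1) / 2
    have z1 : ∀ k, (u (.a k 0)).val 1 = 0 := by
      intro k
      fin_cases k
      · change (u (.a 0 0)).val 1 = 0
        linear_combination (e2 + e4) / 2
      · change (u (.a 1 0)).val 1 = 0
        linear_combination (e4 - e2) / 2
    have htc : (G.t : ℂ) ≠ 0 := by exact_mod_cast ht
    refine hne ((EdgeH2.isSol hq (hs e)).eq_zero_of_ends hq hQ hsym hS ?_ ?_ x hx)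
    · rcases e with ⟨k, j⟩ | k
      · rw [hu.cont_A, z0]
      · have := hu.weighted_A k
        rw [z0, div_eq_zero_iff] at this
        exact this.resolve_right htc
    · rcases e with ⟨k, j⟩ | k
      · have := hu.cont_B k j
        rw [z1, mul_eq_zero] at this
        refine this.resolve_left fun h => ?_
        have := norm_phase θ j
        rw [h, norm_zero] at this
        exact zero_ne_one this
      · have := hu.weighted_B k.rev
        rw [z1, div_eq_zero_iff, Fin.rev_rev] at this
        exact this.resolve_right htc
  · rintro ⟨σ, hσ, h⟩
    obtain ⟨A, B, hne, h1, h2⟩ := exists_secular h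
    have hσ2 : (σ : ℂ) ^ 2 = 1 := by
      rcases hσ with rfl | rfl <;> simp
    simp only [map_sub, Complex.conj_ofReal] at h1
    push_cast at h1 h2
    -- Antisymmetric in the layers for `σ = 1`, symmetric for `σ = -1`.
    refine mem_dispersion_of_vertex_equations ht hQ hsym hS (A := ![A, -σ * A])
      (B := ![B, -σ * B]) (by simpa using hne) ?_ ?_
    · intro k
      fin_cases k
      · simp
        linear_combination h1
      · simp
        linear_combination -(σ : ℂ) * h1 - (G.t : ℂ) ^ 2 * B * hσ2
    · intro k
      fin_cases k
      · simp
        linear_combination h2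
      · simp
        linear_combination -(σ : ℂ) * h2 - (G.t : ℂ) ^ 2 * A * hσ2

end

/-! ### The four roots, the set of energies, and gaps. -/

section

theorem eq_root_iff {ε σ αa αb t x : ℝ} {z : ℂ} :
    x = root ε σ αa αb t z ↔ 2 * ((3 + t ^ 2) * x) + αa + αb =
      ε * √(4 * ‖z - ((σ * t ^ 2 : ℝ) : ℂ)‖ ^ 2 + (αa - αb) ^ 2) := by
  rw [root, eq_div_iff (by positivity)]
  constructor <;> intro h <;> linarith

/-- With `X = 2 (3 + t²) x + αa + αb`, the expression `X² - (αa - αb)²` is four times the product on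
the right side. -/
theorem eq_root_or_iff {σ αa αb t x : ℝ} {z : ℂ} :
    (x = root 1 σ αa αb t z ∨ x = root (-1) σ αa αb t z) ↔
      ((3 + t ^ 2) * x + αa) * ((3 + t ^ 2) * x + αb) = ‖z - ((σ * t ^ 2 : ℝ) : ℂ)‖ ^ 2 := by
  rw [eq_root_iff, eq_root_iff, one_mul, neg_one_mul, ← sq_eq_sq_iff_eq_or_eq_neg,
    Real.sq_sqrt (by positivity)]
  constructor <;> intro h <;> linarith

theorem norm_F_sub_le (θ : Momentum) (t : ℝ) {σ : ℝ} (hσ : σ ∈ ({1, -1} : Set ℝ)) :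
    ‖F θ - ((σ * t ^ 2 : ℝ) : ℂ)‖ ≤ 3 + t ^ 2 := by
  refine (norm_sub_le _ _).trans (add_le_add ?_ ?_)
  · refine (norm_sum_le _ _).trans ?_
    simp [norm_phase]
  · rw [Complex.norm_real, Real.norm_eq_abs, abs_mul, abs_of_nonneg (sq_nonneg t)]
    rcases hσ with rfl | rfl <;> simp

theorem F_of_antidiagonal {θ : Momentum} (h : θ 1 = -θ 0) :
    F θ = ((1 + 2 * Real.cos (θ 0) : ℝ) : ℂ) := by
  have := Complex.two_cos (θ 0)
  simp only [F, Fin.sum_univ_three, phase, Matrix.cons_val, h]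
  push_cast
  rw [this, add_assoc]
  congr 2
  · rw [mul_comm]
  · ring_nf

/-- The antidiagonal point with coordinates `x, -x`. -/
noncomputable def diagPoint (x : ℝ) : Momentum := !₂[x, -x]

theorem F_diagPoint (x : ℝ) : F (diagPoint x) = ((1 + 2 * Real.cos x : ℝ) : ℂ) :=
  F_of_antidiagonal rfl

theorem diagPoint_mem_brillouin {x : ℝ} (h0 : 0 ≤ x) (h1 : x ≤ Real.pi) :
    diagPoint x ∈ brillouin := by
  intro i
  fin_cases i
  · exact ⟨by change -Real.pi ≤ x; linarith, h1⟩
  · exact ⟨by change -Real.pi ≤ -x; linarith, by change -x ≤ Real.pi; linarith⟩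

variable {Q : CI} {lam : ℝ} {G : Bilayer} {θ : Momentum}

theorem discr_mem_Icc (ht : G.t ≠ 0) (hq : ContinuousOn G.q (Icc 0 1)) (hQ : ∀ x, Q x = G.q x)
    (hsym : ∀ x ∈ Icc (0 : ℝ) 1, G.q x = G.q (1 - x)) (h : (θ, lam) ∈ dispersion G) :
    discr G Q lam ∈ Icc 0 ((3 + G.t ^ 2) ^ 2) := by
  by_cases hS : sinEnd Q lam = 0
  · have := sinDerEnd_sq hq hQ hsym hS
    have h' : discr G Q lam = (3 + G.t ^ 2) ^ 2 := by
      rw [discr, hS]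
      linear_combination (3 + G.t ^ 2) ^ 2 * this
    rw [h']
    exact ⟨by positivity, le_rfl⟩
  · obtain ⟨σ, hσ, h⟩ := (mem_dispersion_iff ht hq hQ hsym hS).1 h
    rw [h]
    exact ⟨by positivity, by gcongr; exact norm_F_sub_le θ G.t hσ⟩

/-- Dirichlet eigenvalues belong to the spectrum. -/
theorem mem_spectrumH_of_sinEnd_eq_zero (hQ : ∀ x, Q x = G.q x)
    (hsym : ∀ x ∈ Icc (0 : ℝ) 1, G.q x = G.q (1 - x)) (hS : sinEnd Q lam = 0) :
    lam ∈ spectrumH G := by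
  have hph : ∀ j, phase 0 j = 1 := by
    intro j
    fin_cases j <;> simp [phase]
  obtain ⟨x, hx, hx0⟩ := exists_sinVal_ne_zero (shifted Q lam)
  -- At `θ = 0` the function `s` on one edge and `-s` on a parallel edge of the same layer vanishes
  -- at all vertices, and its flows cancel.
  let c : Edge → ℂ := fun e => match e with
    | .a k j => if k = 0 then ![1, -1, 0] j else 0
    | .f _ => 0
  refine ⟨0, fun i => by simp [Real.pi_pos.le], fun e => solEdge (shifted Q lam) (c e) 0,
    ⟨?_, ?_, ?_, ?_, ?_, ?_⟩, fun e => solves_solEdge hQ hsym _ _, .a 0 0, x, hx, ?_⟩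
  · simp [solEdge_val_zero]
  · simp [solEdge_val_one, hS]
  · simp [solEdge_val_zero]
  · simp [solEdge_val_one, hS]
  · intro k
    by_cases hk : k = 0 <;>
      simp [solEdge_val_zero, solEdge_der_zero, Fin.sum_univ_three, c, hk]
  · intro k
    by_cases hk : k = 0 <;>
      simp [solEdge_val_one, solEdge_der_one, Fin.sum_univ_three, c, hk, hS, hph]
  · simpa [solEdge, EdgeH2.ofClassical, c] using hx0

theorem mem_spectrumH_iff (ht : G.t ∈ Ioo (0 : ℝ) 1) (hq : ContinuousOn G.q (Icc 0 1))
    (hQ : ∀ x, Q x = G.q x) (hsym : ∀ x ∈ Icc (0 : ℝ) 1, G.q x = G.q (1 - x)) :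
    lam ∈ spectrumH G ↔ discr G Q lam ∈ Icc 0 ((3 + G.t ^ 2) ^ 2) := by
  constructor
  · rintro ⟨θ, -, h⟩
    exact discr_mem_Icc ht.1.ne' hq hQ hsym h
  · intro h
    by_cases hS : sinEnd Q lam = 0
    · exact mem_spectrumH_of_sinEnd_eq_zero hQ hsym hS
    · have ht2 : G.t ^ 2 < 1 := by nlinarith [ht.1, ht.2]
      have ht0 : 0 ≤ G.t ^ 2 := sq_nonneg _
      have hr0 := Real.sqrt_nonneg (discr G Q lam)
      have hr : √(discr G Q lam) ≤ 3 + G.t ^ 2 := Real.sqrt_le_iff.2 ⟨by positivity, h.2⟩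
      -- On the diagonal with `σ = -1`, `F + t² = 1 + 2 cos x + t²` covers `[t² - 1, 3 + t²]`; as `t
      -- < 1` this contains `√discr`.
      refine ⟨diagPoint (Real.arccos ((√(discr G Q lam) - 1 - G.t ^ 2) / 2)),
        diagPoint_mem_brillouin (Real.arccos_nonneg _) (Real.arccos_le_pi _),
        (mem_dispersion_iff ht.1.ne' hq hQ hsym hS).2 ⟨-1, by simp, ?_⟩⟩
      rw [F_diagPoint, Real.cos_arccos (by linarith) (by linarith), ← Complex.ofReal_sub,
        Complex.norm_real, Real.norm_eq_abs, sq_abs]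
      have := Real.sq_sqrt h.1
      linear_combination -this

theorem continuous_sinEnd (Q : CI) : Continuous (sinEnd Q) := (contDiff_sinEnd Q).continuous

theorem continuous_sinDerEnd (Q : CI) : Continuous (sinDerEnd Q) :=
  (contDiff_sinDerEnd Q).continuous

theorem isClosed_spectrumH (ht : G.t ∈ Ioo (0 : ℝ) 1) (hq : ContinuousOn G.q (Icc 0 1))
    (hQ : ∀ x, Q x = G.q x) (hsym : ∀ x ∈ Icc (0 : ℝ) 1, G.q x = G.q (1 - x)) :
    IsClosed (spectrumH G) := by
  have h : spectrumH G = discr G Q ⁻¹' Icc 0 ((3 + G.t ^ 2) ^ 2) :=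
    Set.ext fun _ => mem_spectrumH_iff ht hq hQ hsym
  rw [h]
  refine isClosed_Icc.preimage ?_
  have h1 := continuous_sinEnd Q
  have h2 := continuous_sinDerEnd Q
  unfold discr
  fun_prop

/-- An energy outside the spectrum between two energies lies in a gap. -/
theorem exists_isGap (hc : IsClosed (spectrumH G)) {a b mu : ℝ} (ha : a ∈ spectrumH G)
    (hb : b ∈ spectrumH G) (hmu : mu ∈ Icc a b) (hn : mu ∉ spectrumH G) :
    ∃ x y, a ≤ x ∧ y ≤ b ∧ IsGap G x y := by
  have hne1 : (spectrumH G ∩ Iic mu).Nonempty := ⟨a, ha, hmu.1⟩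
  have hne2 : (spectrumH G ∩ Ici mu).Nonempty := ⟨b, hb, hmu.2⟩
  have hb1 : BddAbove (spectrumH G ∩ Iic mu) := ⟨mu, fun _ h => h.2⟩
  have hb2 : BddBelow (spectrumH G ∩ Ici mu) := ⟨mu, fun _ h => h.2⟩
  have h1 := (hc.inter isClosed_Iic).csSup_mem hne1 hb1
  have h2 := (hc.inter isClosed_Ici).csInf_mem hne2 hb2
  -- Closedness makes the nearest energies below and above `mu` attained; they bound the gap.
  refine ⟨sSup (spectrumH G ∩ Iic mu), sInf (spectrumH G ∩ Ici mu), le_csSup hb1 ⟨ha, hmu.1⟩,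
    csInf_le hb2 ⟨hb, hmu.2⟩, ?_, h1.1, h2.1, ?_⟩
  · refine lt_of_lt_of_le (lt_of_le_of_ne h1.2 fun h => hn ?_) h2.2
    rw [← h]
    exact h1.1
  · intro z hz hzS
    rcases le_total z mu with h | h
    · exact (le_csSup hb1 ⟨hzS, h⟩).not_gt hz.1
    · exact (csInf_le hb2 ⟨hzS, h⟩).not_gt hz.2

theorem sinDerEnd_ne_zero (hq : ContinuousOn G.q (Icc 0 1)) (hQ : ∀ x, Q x = G.q x)
    (hsym : ∀ x ∈ Icc (0 : ℝ) 1, G.q x = G.q (1 - x)) (hS : sinEnd Q lam = 0) :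
    sinDerEnd Q lam ≠ 0 := by
  intro h
  have := sinDerEnd_sq hq hQ hsym hS
  rw [h] at this
  norm_num at this

theorem sinEnd_ne_zero_of_robin (hq : ContinuousOn G.q (Icc 0 1)) (hQ : ∀ x, Q x = G.q x)
    (hsym : ∀ x ∈ Icc (0 : ℝ) 1, G.q x = G.q (1 - x)) {m d : ℝ} (hm : m ≠ 0)
    (h : m * sinDerEnd Q lam + d * sinEnd Q lam = 0) : sinEnd Q lam ≠ 0 := by
  intro hS
  rw [hS, mul_zero, add_zero] at h
  exact (mul_ne_zero hm (sinDerEnd_ne_zero hq hQ hsym hS)) h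

/-- Zeros of the mean of the two vertex symbols are outside the spectrum if the vertex parameters
differ. -/
theorem notMem_spectrumH_of_robin (ht : G.t ∈ Ioo (0 : ℝ) 1) (hq : ContinuousOn G.q (Icc 0 1))
    (hQ : ∀ x, Q x = G.q x) (hsym : ∀ x ∈ Icc (0 : ℝ) 1, G.q x = G.q (1 - x))
    (hδ : G.δa ≠ G.δb)
    (h : (3 + G.t ^ 2) * sinDerEnd Q lam + (G.δa + G.δb) / 2 * sinEnd Q lam = 0) :
    lam ∉ spectrumH G := by
  rw [mem_spectrumH_iff ht hq hQ hsym]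
  have hS := sinEnd_ne_zero_of_robin hq hQ hsym (by positivity) h
  -- When the mean vanishes the two symbols are opposite, so their product is minus a square,
  -- nonzero since `s(1) ≠ 0`.
  have hd : discr G Q lam = -((G.δa - G.δb) / 2 * sinEnd Q lam) ^ 2 := by
    rw [discr]
    linear_combination ((3 + G.t ^ 2) * sinDerEnd Q lam + (G.δa + G.δb) / 2 * sinEnd Q lam) * h
  have : 0 < ((G.δa - G.δb) / 2 * sinEnd Q lam) ^ 2 := by
    have := sub_ne_zero.2 hδ
    positivity
  intro hmem
  linarith [hmem.1]

/-- With distinct vertex parameters the bands are separated by the sign of the mean symbol. -/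
theorem pos_of_mem_band (hq : ContinuousOn G.q (Icc 0 1)) (hQ : ∀ x, Q x = G.q x)
    (hsym : ∀ x ∈ Icc (0 : ℝ) 1, G.q x = G.q (1 - x)) (hδ : G.δa ≠ G.δb) {ε : ℝ} (hε : ε ^ 2 = 1)
    (h : (θ, lam) ∈ band G ε) :
    0 < ε * ((3 + G.t ^ 2) * sinDerEnd Q lam + (G.δa + G.δb) / 2 * sinEnd Q lam) := by
  obtain ⟨hS, σ, -, h⟩ := (mem_band_iff hq hQ hsym).1 h
  rw [eq_root_iff] at h
  have hp : 0 < (G.δa * sinEnd Q lam - G.δb * sinEnd Q lam) ^ 2 := by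
    rw [← sub_mul]
    have := sub_ne_zero.2 hδ
    positivity
  have := Real.sqrt_pos.2 (add_pos_of_nonneg_of_pos
    (by positivity : 0 ≤ 4 * ‖F θ - ((σ * G.t ^ 2 : ℝ) : ℂ)‖ ^ 2) hp)
  have h2 : ε * (2 * ((3 + G.t ^ 2) * sinDerEnd Q lam) + G.δa * sinEnd Q lam +
      G.δb * sinEnd Q lam) = √(4 * ‖F θ - ((σ * G.t ^ 2 : ℝ) : ℂ)‖ ^ 2 +
        (G.δa * sinEnd Q lam - G.δb * sinEnd Q lam) ^ 2) := by
    rw [h, ← mul_assoc, ← sq, hε, one_mul]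
  linarith

theorem mem_dispersion_iff_mem_bands (ht : G.t ≠ 0) (hq : ContinuousOn G.q (Icc 0 1))
    (hQ : ∀ x, Q x = G.q x) (hsym : ∀ x ∈ Icc (0 : ℝ) 1, G.q x = G.q (1 - x))
    (hS : sinEnd Q lam ≠ 0) :
    (θ, lam) ∈ dispersion G ↔ (θ, lam) ∈ conduction G ∪ valence G := by
  rw [mem_dispersion_iff ht hq hQ hsym hS, mem_union, conduction, valence,
    mem_band_iff hq hQ hsym, mem_band_iff hq hQ hsym, ← and_or_left]
  simp only [hS, ne_eq, not_false_eq_true, true_and, discr, ← eq_root_or_iff]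
  constructor
  · rintro ⟨σ, hσ, h | h⟩
    · exact .inl ⟨σ, hσ, h⟩
    · exact .inr ⟨σ, hσ, h⟩
  · rintro (⟨σ, hσ, h⟩ | ⟨σ, hσ, h⟩)
    · exact ⟨σ, hσ, .inl h⟩
    · exact ⟨σ, hσ, .inr h⟩

theorem mem_spectrumH_of_mem_bands (ht : G.t ∈ Ioo (0 : ℝ) 1) (hq : ContinuousOn G.q (Icc 0 1))
    (hQ : ∀ x, Q x = G.q x) (hsym : ∀ x ∈ Icc (0 : ℝ) 1, G.q x = G.q (1 - x))
    (h : (θ, lam) ∈ conduction G ∪ valence G) : lam ∈ spectrumH G := by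
  have hS : sinEnd Q lam ≠ 0 := by
    rcases h with h | h <;> exact ((mem_band_iff hq hQ hsym).1 h).1
  exact (mem_spectrumH_iff ht hq hQ hsym).2 (discr_mem_Icc ht.1.ne' hq hQ hsym
    ((mem_dispersion_iff_mem_bands ht.1.ne' hq hQ hsym hS).2 h))

end

/-! ### High energy asymptotics and infinitely many gaps. -/

section

variable {Q : CI} {lam : ℝ} {G : Bilayer} {θ : Momentum}

/-- The solution with Cauchy data `0, 1` at energy `k ^ 2` is close to the free one. -/
theorem norm_sin_sub_exp_le (Q : CI) {k : ℝ} (hk : 0 < k) :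
    ‖(sinDerEnd Q (k ^ 2) + Complex.I * k * sinEnd Q (k ^ 2) : ℂ) - Complex.exp (k * Complex.I)‖ ≤
      Real.exp ((‖Q‖ + 1) / k) - 1 := by
  set K := (‖Q‖ + 1) / k with hK
  have hK0 : 0 < K := by positivity
  have hs := isSol_sin (q := ext Q) (ext_coe Q · |>.symm) (k ^ 2)
  set y := sinVal (shifted Q (k ^ 2)) with hy
  set z := sinDer (shifted Q (k ^ 2)) with hz
  -- Factoring the free rotation `exp(ikx)` out of `s' + iks` leaves the derivative `q s exp(-ikx)`,
  -- and `k |s| ≤ ‖w‖ + 1` makes it at most `K (‖w‖ + 1)`. The `+ 1` in `K` keeps it nonzero for the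
  -- closed Grönwall formula.
  let w : ℝ → ℂ := fun x => (z x + Complex.I * k * y x) * Complex.exp (-(k * x * Complex.I)) - 1
  have hexp : ∀ x : ℝ, ‖Complex.exp (-(k * x * Complex.I))‖ = 1 := fun x => by
    have := Complex.norm_exp_ofReal_mul_I (-(k * x))
    push_cast at this
    rwa [neg_mul] at this
  have hw : ∀ x ∈ Icc (0 : ℝ) 1, HasDerivWithinAt w
      ((ext Q x : ℂ) * y x * Complex.exp (-(k * x * Complex.I))) (Icc 0 1) x := by
    intro x hx
    have h1 := (hs.ofReal (𝕜 := ℂ) x hx).1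
    have h2 := (hs.ofReal (𝕜 := ℂ) x hx).2
    have h3 : HasDerivAt (fun x : ℝ => Complex.exp (-(k * x * Complex.I)))
        (Complex.exp (-(k * x * Complex.I)) * (-(k * 1 * Complex.I))) x :=
      ((((Complex.ofRealCLM.hasDerivAt (x := x)).const_mul (k : ℂ)).mul_const Complex.I).neg).cexp
    refine (((h2.add (h1.const_mul (Complex.I * k))).mul h3.hasDerivWithinAt).sub_const 1).congr_deriv
      ?_
    simp only [Complex.coe_algebraMap, Pi.add_apply]
    push_cast
    linear_combination
      (-(k : ℂ) ^ 2 * y x * Complex.exp (-(k * x * Complex.I))) * Complex.I_sq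
  have hky : ∀ x, k * |y x| ≤ ‖w x‖ + 1 := by
    intro x
    have h1 : k * |y x| ≤ ‖(z x + Complex.I * k * y x : ℂ)‖ := by
      have := Complex.abs_im_le_norm (z x + Complex.I * k * y x : ℂ)
      simpa [abs_mul, abs_of_pos hk] using this
    have h2 : ‖(z x + Complex.I * k * y x : ℂ)‖ = ‖w x + 1‖ := by
      simp [w, hexp]
    rw [h2] at h1
    refine h1.trans ((norm_add_le _ _).trans (by simp))
  have key := norm_le_gronwallBound_of_norm_deriv_right_le (f := w) (δ := 0) (K := K) (ε := K)
    (a := 0) (b := 1) (fun x hx => (hw x hx).continuousWithinAt)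
    (fun x hx => (hw x ⟨hx.1, hx.2.le⟩).mono_of_mem_nhdsWithin
      (mem_of_superset (Icc_mem_nhdsGE_of_mem hx) subset_rfl))
    (by simp [w, hy, hz, sinVal_zero, sinDer_zero]) (fun x _ => ?_) 1 (by simp)
  · rw [gronwallBound_of_K_ne_0 hK0.ne'] at key
    simp only [sub_zero, mul_one, zero_mul, div_self hK0.ne', one_mul, zero_add] at key
    refine le_trans (le_of_eq ?_) key
    have : (sinDerEnd Q (k ^ 2) + Complex.I * k * sinEnd Q (k ^ 2) : ℂ) -
        Complex.exp (k * Complex.I) = Complex.exp (k * Complex.I) * w 1 := by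
      have he : Complex.exp (k * Complex.I) * Complex.exp (-(k * (1 : ℝ) * Complex.I)) = 1 := by
        rw [← Complex.exp_add]
        simp
      simp only [w, sinDerEnd, sinEnd, ← hy, ← hz]
      linear_combination -(z 1 + Complex.I * k * y 1 : ℂ) * he
    rw [this, norm_mul, Complex.norm_exp_ofReal_mul_I, one_mul]
  · rw [norm_mul, hexp, mul_one, norm_mul, Complex.norm_real, Complex.norm_real, Real.norm_eq_abs,
      Real.norm_eq_abs]
    have h1 := abs_ext_le Q x
    have h2 := hky x
    calc |ext Q x| * |y x| ≤ (‖Q‖ + 1) * |y x| := by gcongr; linarith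
      _ = K * (k * |y x|) := by rw [hK]; field_simp
      _ ≤ K * (‖w x‖ + 1) := by gcongr
      _ = _ := by ring

theorem tendsto_exp_div_sub_one (c : ℝ) :
    Tendsto (fun k : ℝ => Real.exp (c / k) - 1) atTop (𝓝 0) := by
  have h : Tendsto (fun k : ℝ => c / k) atTop (𝓝 0) := tendsto_const_nhds.div_atTop tendsto_id
  have := (Real.continuous_exp.tendsto 0).comp h
  simpa using this.sub_const 1

theorem tendsto_sinDerEnd_sub_cos (Q : CI) :
    Tendsto (fun k : ℝ => sinDerEnd Q (k ^ 2) - Real.cos k) atTop (𝓝 0) := by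
  refine squeeze_zero_norm' ?_ (tendsto_exp_div_sub_one (‖Q‖ + 1))
  filter_upwards [eventually_gt_atTop 0] with k hk
  refine le_trans ?_ (norm_sin_sub_exp_le Q hk)
  have := Complex.abs_re_le_norm ((sinDerEnd Q (k ^ 2) + Complex.I * k * sinEnd Q (k ^ 2) : ℂ) -
    Complex.exp (k * Complex.I))
  simpa [Complex.exp_ofReal_mul_I_re] using this

theorem tendsto_mul_sinEnd_sub_sin (Q : CI) :
    Tendsto (fun k : ℝ => k * sinEnd Q (k ^ 2) - Real.sin k) atTop (𝓝 0) := by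
  refine squeeze_zero_norm' ?_ (tendsto_exp_div_sub_one (‖Q‖ + 1))
  filter_upwards [eventually_gt_atTop 0] with k hk
  refine le_trans ?_ (norm_sin_sub_exp_le Q hk)
  have := Complex.abs_im_le_norm ((sinDerEnd Q (k ^ 2) + Complex.I * k * sinEnd Q (k ^ 2) : ℂ) -
    Complex.exp (k * Complex.I))
  simpa [Complex.exp_ofReal_mul_I_im] using this

theorem tendsto_sinEnd (Q : CI) : Tendsto (fun k : ℝ => sinEnd Q (k ^ 2)) atTop (𝓝 0) := by
  have h1 := (tendsto_mul_sinEnd_sub_sin Q).mul (tendsto_inv_atTop_zero (𝕜 := ℝ))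
  have h2 : Tendsto (fun k : ℝ => k⁻¹ * Real.sin k) atTop (𝓝 0) :=
    (tendsto_inv_atTop_zero (𝕜 := ℝ)).zero_mul_isBoundedUnder_le
      (isBoundedUnder_of ⟨1, fun k => Real.abs_sin_le_one k⟩)
  have h3 := h1.add h2
  rw [zero_mul, zero_add] at h3
  refine h3.congr' ?_
  filter_upwards [eventually_gt_atTop 0] with k hk
  field_simp
  ring

theorem tendsto_robin_sub_cos (Q : CI) (m d : ℝ) :
    Tendsto (fun k : ℝ => m * sinDerEnd Q (k ^ 2) + d * sinEnd Q (k ^ 2) - m * Real.cos k)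
      atTop (𝓝 0) := by
  have := ((tendsto_sinDerEnd_sub_cos Q).const_mul m).add ((tendsto_sinEnd Q).const_mul d)
  simp only [mul_zero, add_zero] at this
  exact this.congr fun k => by ring

/-- A sequence of wave numbers along which the cosine is constant. -/
theorem tendsto_robin_arithmetic (Q : CI) (m d φ : ℝ) :
    Tendsto (fun n : ℕ => m * sinDerEnd Q ((φ + n * (2 * Real.pi)) ^ 2) +
      d * sinEnd Q ((φ + n * (2 * Real.pi)) ^ 2)) atTop (𝓝 (m * Real.cos φ)) := by
  have hk : Tendsto (fun n : ℕ => φ + n * (2 * Real.pi)) atTop atTop :=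
    tendsto_atTop_add_const_left _ _ (tendsto_natCast_atTop_atTop.atTop_mul_const
      Real.two_pi_pos)
  have := ((tendsto_robin_sub_cos Q m d).comp hk).add_const (m * Real.cos φ)
  rw [zero_add] at this
  refine this.congr fun n => ?_
  simp [Real.cos_add_nat_mul_two_pi]

theorem tendsto_wavenumber_sq : Tendsto (fun n : ℕ => (Real.pi / 4 + n * (2 * Real.pi)) ^ 2)
    atTop atTop :=
  (tendsto_pow_atTop two_ne_zero).comp (tendsto_atTop_add_const_left _ _
    (tendsto_natCast_atTop_atTop.atTop_mul_const Real.two_pi_pos))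

theorem cos_three_pi_div_four : Real.cos (3 * Real.pi / 4) = -(√2 / 2) := by
  rw [show 3 * Real.pi / 4 = Real.pi - Real.pi / 4 by ring, Real.cos_pi_sub,
    Real.cos_pi_div_four]

/-- Robin functions have zeros between consecutive points of two sequences of energies. -/
theorem eventually_exists_robin_zero (Q : CI) {m : ℝ} (hm : 0 < m) (d : ℝ) :
    ∀ᶠ n : ℕ in atTop, ∃ mu ∈ Icc ((Real.pi / 4 + n * (2 * Real.pi)) ^ 2)
        ((3 * Real.pi / 4 + n * (2 * Real.pi)) ^ 2),
      m * sinDerEnd Q mu + d * sinEnd Q mu = 0 := by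
  have h1 := tendsto_robin_arithmetic Q m d (Real.pi / 4)
  have h2 := tendsto_robin_arithmetic Q m d (3 * Real.pi / 4)
  rw [Real.cos_pi_div_four] at h1
  rw [cos_three_pi_div_four] at h2
  have hs : 0 < m * (√2 / 2) := by positivity
  filter_upwards [h1.eventually (lt_mem_nhds hs),
    h2.eventually (gt_mem_nhds (show m * -(√2 / 2) < 0 by linarith))] with n hn1 hn2
  have hpi := Real.pi_pos
  have hle : (Real.pi / 4 + n * (2 * Real.pi)) ^ 2 ≤ (3 * Real.pi / 4 + n * (2 * Real.pi)) ^ 2 := by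
    gcongr
    linarith
  have hcont : Continuous fun mu => m * sinDerEnd Q mu + d * sinEnd Q mu :=
    (continuous_const.mul (continuous_sinDerEnd Q)).add
      (continuous_const.mul (continuous_sinEnd Q))
  exact intermediate_value_Icc' hle hcont.continuousOn ⟨hn2.le, hn1.le⟩

/-- Along this sequence `discr` tends to `(3 + t²)² / 2`, an interior point of the interval of
admissible values. -/
theorem eventually_discr_mem (Q : CI) (G : Bilayer) {φ : ℝ} (hφ : Real.cos φ ^ 2 = 1 / 2) :
    ∀ᶠ n : ℕ in atTop, discr G Q ((φ + n * (2 * Real.pi)) ^ 2) ∈ Icc 0 ((3 + G.t ^ 2) ^ 2) := by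
  have h := (tendsto_robin_arithmetic Q (3 + G.t ^ 2) G.δa φ).mul
    (tendsto_robin_arithmetic Q (3 + G.t ^ 2) G.δb φ)
  refine h.eventually (Icc_mem_nhds ?_ ?_)
  · have : (3 + G.t ^ 2) * Real.cos φ * ((3 + G.t ^ 2) * Real.cos φ) = (3 + G.t ^ 2) ^ 2 / 2 := by
      linear_combination (3 + G.t ^ 2) ^ 2 * hφ
    rw [this]
    positivity
  · have : (3 + G.t ^ 2) * Real.cos φ * ((3 + G.t ^ 2) * Real.cos φ) = (3 + G.t ^ 2) ^ 2 / 2 := by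
      linear_combination (3 + G.t ^ 2) ^ 2 * hφ
    rw [this]
    exact half_lt_self (by positivity)

/-- For large `n` the wave numbers `π/4 + 2πn` and `3π/4 + 2πn` give energies in the spectrum, and a
zero of the mean symbol lies between them; the resulting gaps are unbounded above. -/
theorem infinite_gaps (ht : G.t ∈ Ioo (0 : ℝ) 1) (hq : ContinuousOn G.q (Icc 0 1))
    (hQ : ∀ x, Q x = G.q x) (hsym : ∀ x ∈ Icc (0 : ℝ) 1, G.q x = G.q (1 - x))
    (hδ : G.δa ≠ G.δb) : {I : ℝ × ℝ | IsGap G I.1 I.2}.Infinite := by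
  refine Set.Infinite.of_image Prod.fst (Set.infinite_of_forall_exists_gt fun M => ?_)
  have hc1 : Real.cos (Real.pi / 4) ^ 2 = 1 / 2 := by
    rw [Real.cos_pi_div_four, div_pow, Real.sq_sqrt zero_le_two]
    norm_num
  have hc2 : Real.cos (3 * Real.pi / 4) ^ 2 = 1 / 2 := by
    rw [cos_three_pi_div_four, ← hc1, Real.cos_pi_div_four]
    ring
  obtain ⟨n, ⟨mu, hmu, h0⟩, h1, h2, h3⟩ :=
    ((eventually_exists_robin_zero Q (m := 3 + G.t ^ 2) (by positivity)
      ((G.δa + G.δb) / 2)).and ((eventually_discr_mem Q G hc1).and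
      ((eventually_discr_mem Q G hc2).and
        (tendsto_wavenumber_sq.eventually (eventually_gt_atTop M))))).exists
  obtain ⟨x, y, hx, hy, hg⟩ := exists_isGap (isClosed_spectrumH ht hq hQ hsym)
    ((mem_spectrumH_iff ht hq hQ hsym).2 h1) ((mem_spectrumH_iff ht hq hQ hsym).2 h2) hmu
    (notMem_spectrumH_of_robin ht hq hQ hsym hδ h0)
  exact ⟨x, ⟨(x, y), hg, rfl⟩, h3.trans_le hx⟩

theorem infinite_robin_zeros (Q : CI) {m : ℝ} (hm : 0 < m) (d : ℝ) :
    {mu | m * sinDerEnd Q mu + d * sinEnd Q mu = 0}.Infinite := by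
  refine Set.infinite_of_forall_exists_gt fun M => ?_
  obtain ⟨n, ⟨mu, hmu, h0⟩, h1⟩ := ((eventually_exists_robin_zero Q hm d).and
    (tendsto_wavenumber_sq.eventually (eventually_gt_atTop M))).exists
  exact ⟨mu, h0, h1.trans_le hmu.1⟩

/-- The mean symbol changes sign between the two energies, in whichever order they stand, and its
zero is outside the spectrum. -/
theorem exists_gap_between (ht : G.t ∈ Ioo (0 : ℝ) 1) (hq : ContinuousOn G.q (Icc 0 1))
    (hQ : ∀ x, Q x = G.q x) (hsym : ∀ x ∈ Icc (0 : ℝ) 1, G.q x = G.q (1 - x))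
    (hδ : G.δa ≠ G.δb) {lc lv : ℝ} {θ θ' : Momentum} (hc : (θ, lc) ∈ conduction G)
    (hv : (θ', lv) ∈ valence G) :
    ∃ x y : ℝ, min lc lv ≤ x ∧ y ≤ max lc lv ∧ IsGap G x y := by
  have pc := pos_of_mem_band hq hQ hsym hδ (one_pow 2) hc
  have pv := pos_of_mem_band hq hQ hsym hδ (by norm_num) hv
  have sc := mem_spectrumH_of_mem_bands ht hq hQ hsym (.inl hc)
  have sv := mem_spectrumH_of_mem_bands ht hq hQ hsym (.inr hv)
  have hcont : Continuous fun mu => (3 + G.t ^ 2) * sinDerEnd Q mu +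
      (G.δa + G.δb) / 2 * sinEnd Q mu :=
    (continuous_const.mul (continuous_sinDerEnd Q)).add
      (continuous_const.mul (continuous_sinEnd Q))
  obtain ⟨mu, hmu, h0⟩ := intermediate_value_uIcc (a := lv) (b := lc) hcont.continuousOn
    (show (0 : ℝ) ∈ uIcc _ _ from mem_uIcc_of_le (by linarith) (by linarith))
  rw [uIcc_comm] at hmu
  refine exists_isGap (isClosed_spectrumH ht hq hQ hsym) ?_ ?_ hmu
    (notMem_spectrumH_of_robin ht hq hQ hsym hδ h0)
  · rcases min_choice lc lv with h | h <;> rwa [h]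
  · rcases max_choice lc lv with h | h <;> rwa [h]

end

/-! ### Local inversion in the energy, simplicity of zeros, linearity of `|F - σ t²|`. -/

section

/-- The first order Taylor formula for a twice continuously differentiable function. -/
theorem isBigO_taylor_one {f : ℝ → ℝ} {a d : ℝ} (hf : ContDiffAt ℝ 2 f a)
    (hd : HasDerivAt f d a) :
    (fun x => f x - f a - d * (x - a)) =O[𝓝 a] (fun x => (x - a) ^ 2) := by
  have h1 : ∀ᶠ x in 𝓝 a, DifferentiableAt ℝ f x :=
    (hf.eventually (by simp)).mono fun x hx => hx.differentiableAt (by simp)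
  have h2 : DifferentiableAt ℝ (deriv f) a :=
    (hf.derivWithin (m := 1) (by norm_num)).differentiableAt (by simp)
  obtain ⟨C, hC0, hC⟩ := h2.isBigO_sub.exists_pos
  rw [IsBigOWith] at hC
  obtain ⟨r, hr, hball⟩ := Metric.eventually_nhds_iff_ball.1 (h1.and hC)
  refine IsBigO.of_bound C ?_
  filter_upwards [Metric.ball_mem_nhds a hr] with x hx
  have hsub : ∀ y ∈ uIcc a x, y ∈ Metric.ball a r := fun y hy =>
    lt_of_le_of_lt (abs_sub_left_of_mem_uIcc hy) hx
  -- Mean value inequality for `f y - d (y - a)`, whose derivative is `O(|y - a|)` on the segment.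
  have key := (convex_uIcc a x).norm_image_sub_le_of_norm_hasDerivWithin_le
    (f := fun y => f y - d * (y - a)) (f' := fun y => deriv f y - deriv f a) (C := C * |x - a|)
    (x := a) (y := x) (fun y hy => ?_) (fun y hy => ?_) left_mem_uIcc right_mem_uIcc
  · simp only [sub_self, mul_zero, sub_zero, Real.norm_eq_abs] at key ⊢
    rw [abs_pow, sq, ← mul_assoc]
    convert key using 2
    ring
  · have h3 := (hball y (hsub y hy)).1.hasDerivAt
    rw [hd.deriv]
    exact (h3.sub (((hasDerivAt_id y).sub_const a).const_mul d)).hasDerivWithinAt.congr_deriv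
      (by simp)
  · refine (hball y (hsub y hy)).2.trans ?_
    gcongr
    exact abs_sub_left_of_mem_uIcc hy

/-- A local inverse with its first order expansion. -/
theorem exists_local_inverse {f : ℝ → ℝ} {a d : ℝ} (hf : ContDiffAt ℝ 2 f a)
    (hd : HasDerivAt f d a) (hd0 : d ≠ 0) (h0 : f a = 0) :
    ∃ g : ℝ → ℝ, g 0 = a ∧ (∀ᶠ p in 𝓝 (0 : ℝ) ×ˢ 𝓝 a, f p.2 = p.1 ↔ p.2 = g p.1) ∧
      (fun y => g y - a - d⁻¹ * y) =O[𝓝 0] (fun y => y ^ 2) := by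
  have hs : HasStrictDerivAt f d a := hf.hasStrictDerivAt' hd (by simp)
  have hse := hs.hasStrictFDerivAt_equiv hd0
  have hda := hse.hasFDerivAt
  set g := hf.localInverse hda (by simp) with hg
  have hga : g 0 = a := h0 ▸ hf.localInverse_apply_image hda (by simp)
  have hl : ∀ᶠ x in 𝓝 a, g (f x) = x := hse.eventually_left_inverse
  have hr : ∀ᶠ y in 𝓝 (0 : ℝ), f (g y) = y := h0 ▸ hse.eventually_right_inverse
  refine ⟨g, hga, ?_, ?_⟩
  · filter_upwards [hr.prod_mk hl] with p hp
    constructor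
    · intro h
      rw [← h, hp.2]
    · intro h
      rw [h, hp.1]
  · have hgc : ContDiffAt ℝ 2 g 0 := h0 ▸ hf.to_localInverse hda (by simp)
    have hgd : HasDerivAt g d⁻¹ 0 := by
      have := (hs.to_local_left_inverse hd0 hl).hasDerivAt
      rwa [h0] at this
    simpa [hga] using isBigO_taylor_one hgc hgd

variable {Q : CI} {lam mu : ℝ} {G : Bilayer} {θ : Momentum}

/-- The derivative at `mu` of the Wronskian of the solutions at `lam` and `mu`. -/
theorem hasDerivAt_wronskian (Q : CI) (mu : ℝ) :
    HasDerivAt (fun lam => sinEnd Q lam * sinDerEnd Q mu - sinDerEnd Q lam * sinEnd Q mu)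
      (∫ x in (0 : ℝ)..1, sinVal (shifted Q mu) x * sinVal (shifted Q mu) x) mu := by
  have hint : ∀ lam, ∫ x in (0 : ℝ)..1, sinVal (shifted Q lam) x * sinVal (shifted Q mu) x =
      primitive (volterraSol (shifted Q lam) * volterraSol (shifted Q mu)) 1 := by
    intro lam
    rw [primitive_apply]
    refine intervalIntegral.integral_congr fun x hx => ?_
    rw [uIcc_of_le zero_le_one] at hx
    simp only [ext_of_mem _ hx, ContinuousMap.mul_apply, ← sinVal_coe]
  have hcont : Continuous fun lam =>
      ∫ x in (0 : ℝ)..1, sinVal (shifted Q lam) x * sinVal (shifted Q mu) x := by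
    simp_rw [hint]
    have h1 : Continuous fun lam => volterraSol (shifted Q lam) :=
      (contDiff_volterraSol.comp (contDiff_shifted Q)).continuous
    exact (ContinuousMap.evalCLM ℝ (1 : Icc (0 : ℝ) 1) : CI →L[ℝ] ℝ).continuous.comp
      (primitive.continuous.comp (h1.mul continuous_const))
  rw [hasDerivAt_iff_tendsto_slope]
  -- By Lagrange's identity the difference quotient is exactly the integral of the product of the
  -- two solutions, which is continuous in `lam`.
  refine ((hcont.tendsto mu).mono_left nhdsWithin_le_nhds).congr' ?_
  filter_upwards [self_mem_nhdsWithin] with lam hlam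
  have h := (isSol_sin (q := ext Q) (ext_coe Q · |>.symm) lam).lagrange
    (isSol_sin (q := ext Q) (ext_coe Q · |>.symm) mu)
  have hne : lam - mu ≠ 0 := sub_ne_zero.2 hlam
  simp only [sinVal_zero, zero_mul, mul_zero, sub_zero] at h
  rw [slope_def_field, sub_eq_zero.2 (mul_comm (sinEnd Q mu) _), sub_zero, eq_div_iff hne,
    mul_comm, ← h]
  rfl

theorem integral_sinVal_sq_pos (p : CI) : 0 < ∫ x in (0 : ℝ)..1, sinVal p x * sinVal p x := by
  have hc : Continuous (sinVal p) :=
    continuous_iff_continuousAt.2 fun x => (hasDerivAt_sinVal p x).continuousAt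
  obtain ⟨x, hx, hx0⟩ := exists_sinVal_ne_zero p
  exact intervalIntegral.integral_pos one_pos (hc.mul hc).continuousOn
    (fun y _ => mul_self_nonneg _) ⟨x, hx, mul_self_pos.2 hx0⟩

/-- Zeros of Robin functions are simple. -/
theorem robin_deriv_ne_zero {m e d : ℝ}
    (h0 : m * sinDerEnd Q mu + e * sinEnd Q mu = 0)
    (hd : HasDerivAt (fun lam => m * sinDerEnd Q lam + e * sinEnd Q lam) d mu) (hm : m ≠ 0) :
    d ≠ 0 := by
  rintro rfl
  have h1 := (hasDerivAt_wronskian Q mu).const_mul m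
  have h2 := hd.const_mul (-sinEnd Q mu)
  -- The relation `h0` turns `m` times the Wronskian into a multiple of the Robin function; a double
  -- zero would force `∫ s² = 0`.
  have he : (fun lam => m * (sinEnd Q lam * sinDerEnd Q mu - sinDerEnd Q lam * sinEnd Q mu)) =
      fun lam => -sinEnd Q mu * (m * sinDerEnd Q lam + e * sinEnd Q lam) := by
    ext lam
    linear_combination sinEnd Q lam * h0
  rw [he] at h1
  have := h1.unique h2
  rw [mul_zero, mul_eq_zero] at this
  exact (integral_sinVal_sq_pos (shifted Q mu)).ne' (this.resolve_left hm)

theorem norm_sub_of_mem_brillouinDiag {θ θD : Momentum} (h : θ ∈ brillouinDiag)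
    (hD : θD ∈ brillouinDiag) : ‖θ - θD‖ = √2 * |θ 0 - θD 0| := by
  rw [EuclideanSpace.norm_eq, Fin.sum_univ_two]
  simp only [PiLp.sub_apply, h.2, hD.2, Real.norm_eq_abs, sq_abs]
  rw [← Real.sqrt_sq_eq_abs, ← Real.sqrt_mul zero_le_two]
  congr 1
  ring

/-- If the sine vanishes then `F` is `3` or `-1`, which is impossible because `0 < t² < 1`. -/
theorem sin_ne_zero_of_F_eq {t σ : ℝ} (ht : t ∈ Ioo (0 : ℝ) 1) (hσ : σ ∈ ({1, -1} : Set ℝ))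
    {θD : Momentum} (hD : θD ∈ brillouinDiag) (hF : F θD = ((σ * t ^ 2 : ℝ) : ℂ)) :
    Real.sin (θD 0) ≠ 0 := by
  intro hs
  rw [F_of_antidiagonal hD.2, Complex.ofReal_inj] at hF
  have h1 := Real.sin_sq_add_cos_sq (θD 0)
  have ht2 : t ^ 2 < 1 := by nlinarith [ht.1, ht.2]
  have ht0 : 0 < t ^ 2 := pow_pos ht.1 2
  rw [hs] at h1
  rcases hσ with rfl | rfl <;> nlinarith

/-- The linear behaviour of `|F - σ t²|` along the antidiagonal. -/
theorem isBigO_norm_F_sub {t σ : ℝ} {θD : Momentum} (hD : θD ∈ brillouinDiag)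
    (hF : F θD = ((σ * t ^ 2 : ℝ) : ℂ)) :
    (fun θ => ‖F θ - ((σ * t ^ 2 : ℝ) : ℂ)‖ - √2 * |Real.sin (θD 0)| * ‖θ - θD‖)
      =O[𝓝[brillouinDiag] θD] (fun θ => ‖θ - θD‖ ^ 2) := by
  have hcos := isBigO_taylor_one (a := θD 0) Real.contDiff_cos.contDiffAt (Real.hasDerivAt_cos _)
  have htend : Tendsto (fun θ : Momentum => θ 0) (𝓝[brillouinDiag] θD) (𝓝 (θD 0)) :=
    ((by fun_prop : Continuous fun θ : Momentum => θ 0).tendsto θD).mono_left nhdsWithin_le_nhds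
  have h2 : √2 * √2 = (2 : ℝ) := Real.mul_self_sqrt zero_le_two
  refine IsBigO.trans ?_ ((hcos.comp_tendsto htend).trans ?_)
  · refine IsBigO.of_bound 2 ?_
    filter_upwards [self_mem_nhdsWithin] with θ hθ
    rw [← hF, F_of_antidiagonal hθ.2, F_of_antidiagonal hD.2, ← Complex.ofReal_sub,
      Complex.norm_real, norm_sub_of_mem_brillouinDiag hθ hD, Real.norm_eq_abs, Real.norm_eq_abs,
      Real.norm_eq_abs]
    -- One factor `√2` comes from `‖θ - θD‖ = √2 |θ₁ - θD₁|`; together they give the `2` of `F = 1 +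
    -- 2 cos θ₁`.
    have e1 : √2 * |Real.sin (θD 0)| * (√2 * |θ 0 - θD 0|) =
        |-(2 * (Real.sin (θD 0) * (θ 0 - θD 0)))| := by
      rw [abs_neg, abs_mul, abs_mul, abs_two]
      linear_combination |Real.sin (θD 0)| * |θ 0 - θD 0| * h2
    rw [e1]
    refine (abs_abs_sub_abs_le _ _).trans (le_of_eq ?_)
    rw [← abs_two, ← abs_mul, abs_two]
    congr 1
    simp only [Function.comp_apply]
    ring
  · refine IsBigO.of_bound 1 ?_
    filter_upwards [self_mem_nhdsWithin] with θ hθ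
    rw [norm_sub_of_mem_brillouinDiag hθ hD]
    simp only [Function.comp_apply, norm_pow, norm_mul, Real.norm_eq_abs, abs_abs, one_mul,
      Nat.abs_ofNat, mul_pow, Real.sq_sqrt zero_le_two]
    linarith [sq_nonneg |θ 0 - θD 0|]

end

/-! ### Dirac cones and the root functions with constant parameters. -/

section

variable {Q : CI} {lam mu : ℝ} {G : Bilayer} {θ θD : Momentum}

theorem mem_band_iff_of_eq (hq : ContinuousOn G.q (Icc 0 1)) (hQ : ∀ x, Q x = G.q x)
    (hsym : ∀ x ∈ Icc (0 : ℝ) 1, G.q x = G.q (1 - x)) (hδ : G.δa = G.δb) {ε : ℝ} :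
    (θ, lam) ∈ band G ε ↔ sinEnd Q lam ≠ 0 ∧ ∃ σ ∈ ({1, -1} : Set ℝ),
      (3 + G.t ^ 2) * sinDerEnd Q lam + G.δa * sinEnd Q lam =
        ε * ‖F θ - ((σ * G.t ^ 2 : ℝ) : ℂ)‖ := by
  rw [mem_band_iff hq hQ hsym]
  refine and_congr_right fun _ => exists_congr fun σ => and_congr_right fun _ => ?_
  have h4 : √(4 * ‖F θ - ((σ * G.t ^ 2 : ℝ) : ℂ)‖ ^ 2) = 2 * ‖F θ - ((σ * G.t ^ 2 : ℝ) : ℂ)‖ := by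
    rw [show (4 : ℝ) * ‖F θ - ((σ * G.t ^ 2 : ℝ) : ℂ)‖ ^ 2 =
      (2 * ‖F θ - ((σ * G.t ^ 2 : ℝ) : ℂ)‖) ^ 2 by ring, Real.sqrt_sq (by positivity)]
  rw [eq_root_iff, ← hδ, sub_self, zero_pow two_ne_zero, add_zero, h4]
  constructor <;> intro h <;> linarith

theorem continuous_F : Continuous F := by
  have h : F = fun θ => 1 + Complex.exp (Complex.I * (θ 0 : ℂ)) +
      Complex.exp (Complex.I * (θ 1 : ℂ)) := by
    ext θ
    simp [F, Fin.sum_univ_three, phase]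
  rw [h]
  fun_prop

/-- Near a point with `F = σ t²` and a zero of the Robin function only one of the roots of each
sign is close. -/
theorem eventually_mem_band_iff (ht : G.t ∈ Ioo (0 : ℝ) 1) (hq : ContinuousOn G.q (Icc 0 1))
    (hQ : ∀ x, Q x = G.q x) (hsym : ∀ x ∈ Icc (0 : ℝ) 1, G.q x = G.q (1 - x)) (hδ : G.δa = G.δb)
    {ε σ : ℝ} (hε : ε ∈ ({1, -1} : Set ℝ)) (hσ : σ ∈ ({1, -1} : Set ℝ))
    (hF : F θD = ((σ * G.t ^ 2 : ℝ) : ℂ))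
    (h0 : (3 + G.t ^ 2) * sinDerEnd Q mu + G.δa * sinEnd Q mu = 0) :
    ∀ᶠ p in 𝓝 θD ×ˢ 𝓝 mu, (p ∈ band G ε ↔
      (3 + G.t ^ 2) * sinDerEnd Q p.2 + G.δa * sinEnd Q p.2 =
        ε * ‖F p.1 - ((σ * G.t ^ 2 : ℝ) : ℂ)‖) := by
  have hS := sinEnd_ne_zero_of_robin hq hQ hsym (by positivity) h0
  have c1 := continuous_sinEnd Q
  have c2 := continuous_sinDerEnd Q
  have c3 := continuous_F
  have e1 : ∀ᶠ p : Momentum × ℝ in 𝓝 (θD, mu), sinEnd Q p.2 ≠ 0 :=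
    (c1.comp continuous_snd).continuousAt.eventually_ne hS
  -- At the centre the Robin function is `0` while the opposite shift gives `|F + σ t²| = 2t² > 0`,
  -- so that root stays away.
  have e2 : ∀ᶠ p : Momentum × ℝ in 𝓝 (θD, mu),
      |(3 + G.t ^ 2) * sinDerEnd Q p.2 + G.δa * sinEnd Q p.2| <
        ‖F p.1 - ((-σ * G.t ^ 2 : ℝ) : ℂ)‖ := by
    refine ContinuousAt.eventually_lt (by fun_prop) (by fun_prop) ?_
    simp only [h0, abs_zero, norm_pos_iff, hF, sub_ne_zero, ne_eq, Complex.ofReal_inj]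
    have := pow_pos ht.1 2
    rcases hσ with rfl | rfl <;> intro h <;> linarith
  rw [nhds_prod_eq] at e1 e2
  filter_upwards [e1, e2] with p h1 h2
  rw [mem_band_iff_of_eq hq hQ hsym hδ]
  refine ⟨?_, fun h => ⟨h1, σ, hσ, h⟩⟩
  rintro ⟨-, σ', hσ', h⟩
  by_cases hs : σ' = σ
  · rwa [← hs]
  · exfalso
    have hs' : σ' = -σ := by
      rcases hσ with rfl | rfl <;> rcases hσ' with rfl | rfl
      exacts [absurd rfl hs, rfl, (neg_neg _).symm, absurd rfl hs]
    have hε1 : |ε| = 1 := by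
      rcases hε with rfl | rfl <;> simp
    rw [h, abs_mul, abs_norm, hs', hε1, one_mul] at h2
    exact lt_irrefl _ h2

theorem isDiracCone_of_robin_zero (ht : G.t ∈ Ioo (0 : ℝ) 1) (hq : ContinuousOn G.q (Icc 0 1))
    (hQ : ∀ x, Q x = G.q x) (hsym : ∀ x ∈ Icc (0 : ℝ) 1, G.q x = G.q (1 - x)) (hδ : G.δa = G.δb)
    {σ : ℝ} (hσ : σ ∈ ({1, -1} : Set ℝ)) (hD : θD ∈ brillouinDiag)
    (hF : F θD = ((σ * G.t ^ 2 : ℝ) : ℂ))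
    (h0 : (3 + G.t ^ 2) * sinDerEnd Q mu + G.δa * sinEnd Q mu = 0) : IsDiracCone G mu θD := by
  have hS := sinEnd_ne_zero_of_robin hq hQ hsym (by positivity) h0
  have hm : (3 + G.t ^ 2) ≠ 0 := by positivity
  have hcd : ContDiff ℝ 2 fun lam => (3 + G.t ^ 2) * sinDerEnd Q lam + G.δa * sinEnd Q lam :=
    (contDiff_const.mul (contDiff_sinDerEnd Q)).add (contDiff_const.mul (contDiff_sinEnd Q))
  have hd := (hcd.differentiable (by simp) mu).hasDerivAt
  have hd0 := robin_deriv_ne_zero h0 hd hm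
  obtain ⟨g, hg0, hgiff, hgO⟩ := exists_local_inverse hcd.contDiffAt hd hd0 h0
  set d := deriv (fun lam => (3 + G.t ^ 2) * sinDerEnd Q lam + G.δa * sinEnd Q lam) mu
  set N : Momentum → ℝ := fun θ => ‖F θ - ((σ * G.t ^ 2 : ℝ) : ℂ)‖ with hN
  set c := √2 * |Real.sin (θD 0)| with hc
  have hc0 : c ≠ 0 := mul_ne_zero (by simp) (abs_ne_zero.2 (sin_ne_zero_of_F_eq ht hσ hD hF))
  have hNO := isBigO_norm_F_sub hD hF
  have hND : N θD = 0 := by simp [hN, hF]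
  have hNt : Tendsto N (𝓝[brillouinDiag] θD) (𝓝 0) := by
    rw [← hND]
    have := continuous_F
    exact (Continuous.tendsto (by fun_prop) θD).mono_left nhdsWithin_le_nhds
  have hsqO : (fun θ => ‖θ - θD‖ ^ 2) =O[𝓝[brillouinDiag] θD] (fun θ => ‖θ - θD‖) := by
    have ht : Tendsto (fun θ => ‖θ - θD‖) (𝓝[brillouinDiag] θD) (𝓝 0) := by
      have : Continuous fun θ : Momentum => ‖θ - θD‖ := by fun_prop
      simpa using (this.tendsto θD).mono_left nhdsWithin_le_nhds
    have := (ht.isBigO_one ℝ).mul (isBigO_refl (fun θ => ‖θ - θD‖) (𝓝[brillouinDiag] θD))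
    simpa [sq] using this
  have hNlin : N =O[𝓝[brillouinDiag] θD] (fun θ => ‖θ - θD‖) := by
    have := (hNO.trans hsqO).add ((isBigO_refl (fun θ => ‖θ - θD‖) _).const_mul_left c)
    exact this.congr_left fun θ => by ring
  -- Composing the expansions of `g` and `N` gives the slope `ε c / d`; since `d` may have either
  -- sign, the cone slope is only known to be nonzero.
  have expand : ∀ ε : ℝ, (fun θ => g (ε * N θ) - mu - ε * (d⁻¹ * c) * ‖θ - θD‖)
      =O[𝓝[brillouinDiag] θD] (fun θ => ‖θ - θD‖ ^ 2) := by
    intro ε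
    have ht' : Tendsto (fun θ => ε * N θ) (𝓝[brillouinDiag] θD) (𝓝 0) := by
      simpa using hNt.const_mul ε
    have h1 := (hgO.comp_tendsto ht').trans ((hNlin.const_mul_left ε).pow 2)
    have h2 := hNO.const_mul_left (ε * d⁻¹)
    refine (h1.add h2).congr_left fun θ => ?_
    simp only [Function.comp_apply, hN]
    ring
  have bands : ∀ ε ∈ ({1, -1} : Set ℝ), ∀ᶠ p in 𝓝[brillouinDiag] θD ×ˢ 𝓝 mu,
      (p ∈ band G ε ↔ p.2 = g (ε * N p.1)) := by
    intro ε hε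
    have ht' : Tendsto (fun θ => ε * N θ) (𝓝[brillouinDiag] θD) (𝓝 0) := by
      simpa using hNt.const_mul ε
    have hle : 𝓝[brillouinDiag] θD ×ˢ 𝓝 mu ≤ 𝓝 θD ×ˢ 𝓝 mu :=
      Filter.prod_mono_left _ nhdsWithin_le_nhds
    filter_upwards [hle (eventually_mem_band_iff ht hq hQ hsym hδ hε hσ hF h0),
      (ht'.prodMap tendsto_id).eventually hgiff] with p h1 h2
    exact h1.trans h2
  have hmem : (θD, mu) ∈ conduction G :=
    (mem_band_iff_of_eq hq hQ hsym hδ).2 ⟨hS, σ, hσ, by rw [h0]; simp [hF]⟩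
  refine ⟨hD, (mem_dispersion_iff_mem_bands ht.1.ne' hq hQ hsym hS).2 (.inl hmem), d⁻¹ * c,
    mul_ne_zero (inv_ne_zero hd0) hc0, fun θ => g (1 * N θ), fun θ => g (-1 * N θ), ?_, ?_, ?_,
    ?_, ?_⟩
  · simp [hND, hg0]
  · simp [hND, hg0]
  · exact (bands 1 (by simp)).and (bands (-1) (by simp))
  · simpa using expand 1
  · refine (expand (-1)).congr_left fun θ => ?_
    ring

theorem F_eq_iff {t σ : ℝ} (ht : t ∈ Ioo (0 : ℝ) 1) (hσ : σ ∈ ({1, -1} : Set ℝ))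
    (hθ : θ ∈ brillouinDiag) :
    F θ = ((σ * t ^ 2 : ℝ) : ℂ) ↔ |θ 0| = Real.arccos ((σ * t ^ 2 - 1) / 2) := by
  have ht2 : t ^ 2 < 1 := by nlinarith [ht.1, ht.2]
  have ht0 : 0 < t ^ 2 := pow_pos ht.1 2
  have hpi : |θ 0| ≤ Real.pi := abs_le.2 (hθ.1 0)
  rw [F_of_antidiagonal hθ.2, Complex.ofReal_inj, ← Real.cos_abs]
  constructor
  · intro h
    rw [← h, add_sub_cancel_left, mul_div_cancel_left₀ _ two_ne_zero,
      Real.arccos_cos (abs_nonneg _) hpi]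
  · intro h
    rw [h, Real.cos_arccos]
    · ring
    · rcases hσ with rfl | rfl <;> linarith
    · rcases hσ with rfl | rfl <;> linarith

theorem root_eq_of_eq {ε σ α t : ℝ} {z : ℂ} :
    root ε σ α α t z = (-α + ε * ‖z - ((σ * t ^ 2 : ℝ) : ℂ)‖) / (3 + t ^ 2) := by
  rw [eq_comm, eq_root_iff, mul_div_cancel₀ _ (by positivity : 3 + t ^ 2 ≠ 0), sub_self,
    zero_pow two_ne_zero, add_zero,
    show (4 : ℝ) * ‖z - ((σ * t ^ 2 : ℝ) : ℂ)‖ ^ 2 = (2 * ‖z - ((σ * t ^ 2 : ℝ) : ℂ)‖) ^ 2 by ring,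
    Real.sqrt_sq (by positivity)]
  ring

theorem root_linear {t σ α : ℝ} (ht : t ∈ Ioo (0 : ℝ) 1) (hσ : σ ∈ ({1, -1} : Set ℝ))
    (hD : θD ∈ brillouinDiag) (hF : F θD = ((σ * t ^ 2 : ℝ) : ℂ)) :
    ∃ γ : ℝ, 0 < γ ∧ ∀ ε ∈ ({1, -1} : Set ℝ),
      (fun θ => root ε σ α α t (F θ) - root ε σ α α t (F θD) - ε * γ * ‖θ - θD‖)
        =O[𝓝[brillouinDiag] θD] (fun θ => ‖θ - θD‖ ^ 2) := by
  have hs := abs_pos.2 (sin_ne_zero_of_F_eq ht hσ hD hF)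
  refine ⟨√2 * |Real.sin (θD 0)| / (3 + t ^ 2), by positivity, fun ε _ => ?_⟩
  refine ((isBigO_norm_F_sub hD hF).const_mul_left (ε / (3 + t ^ 2))).congr_left fun θ => ?_
  rw [root_eq_of_eq, root_eq_of_eq, hF, sub_self, norm_zero]
  ring

/-- All roots are centred at the same point, and the square root is at least `|αa - αb|` for every
`z`. -/
theorem root_gap (αa αb t σ σ' : ℝ) (z z' : ℂ) :
    |αa - αb| / (3 + t ^ 2) ≤ root 1 σ αa αb t z - root (-1) σ' αa αb t z' := by
  have h : ∀ x : ℝ, 0 ≤ x → |αa - αb| ≤ √(4 * x + (αa - αb) ^ 2) := fun x hx =>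
    Real.abs_le_sqrt (by linarith)
  have h1 := h (‖z - ((σ * t ^ 2 : ℝ) : ℂ)‖ ^ 2) (by positivity)
  have h2 := h (‖z' - ((σ' * t ^ 2 : ℝ) : ℂ)‖ ^ 2) (by positivity)
  rw [root, root, ← sub_div, div_le_div_iff₀ (by positivity) (by positivity)]
  have hm : 0 < 3 + t ^ 2 := by positivity
  nlinarith

end

end AAPrime

open AAPrime in
theorem mainTheorem3 (G : Bilayer) (ht : G.t ∈ Ioo (0 : ℝ) 1)
    (hq : ContinuousOn G.q (Icc 0 1)) (hsym : ∀ x ∈ Icc (0 : ℝ) 1, G.q x = G.q (1 - x)) :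
    -- location of the points with `F = ± t²` on the diagonal
    (∀ σ ∈ ({1, -1} : Set ℝ), ∀ θ ∈ brillouinDiag,
      F θ = ((σ * G.t ^ 2 : ℝ) : ℂ) ↔ |θ 0| = Real.arccos ((σ * G.t ^ 2 - 1) / 2)) ∧
    -- away from the Dirichlet spectrum the dispersion relation is given by the four roots
    (∀ (θ : Momentum) (lam : ℝ), lam ∉ dirichletSpectrum G.q →
      ((θ, lam) ∈ dispersion G ↔ (θ, lam) ∈ conduction G ∪ valence G)) ∧
    -- (a) equal parameters: Dirac cones at `F = ± t²`
    (G.δa = G.δb → G.δa ≠ 0 →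
      ∀ σ ∈ ({1, -1} : Set ℝ), ∀ θD ∈ brillouinDiag, F θD = ((σ * G.t ^ 2 : ℝ) : ℂ) →
        (∀ lam : ℝ, (θD, lam) ∈ conduction G → (θD, lam) ∈ valence G →
          IsDiracCone G lam θD) ∧
        {lam : ℝ | IsDiracCone G lam θD}.Infinite) ∧
    -- (b) distinct parameters: no touch, and gaps
    (G.δa ≠ G.δb →
      (∀ (lam : ℝ) (θ θ' : Momentum), (θ, lam) ∈ conduction G → (θ', lam) ∉ valence G) ∧
      (∀ (lc lv : ℝ) (θ θ' : Momentum), (θ, lc) ∈ conduction G → (θ', lv) ∈ valence G →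
        ∃ x y : ℝ, min lc lv ≤ x ∧ y ≤ max lc lv ∧ IsGap G x y) ∧
      {I : ℝ × ℝ | IsGap G I.1 I.2}.Infinite) ∧
    -- (a) and (b) for the four root functions with constant `αa`, `αb`
    (∀ αa αb : ℝ,
      (αa = αb → αa ≠ 0 →
        ∀ σ ∈ ({1, -1} : Set ℝ), ∀ θD ∈ brillouinDiag, F θD = ((σ * G.t ^ 2 : ℝ) : ℂ) →
          root 1 σ αa αb G.t (F θD) = root (-1) σ αa αb G.t (F θD) ∧
          ∃ γ : ℝ, 0 < γ ∧ ∀ ε ∈ ({1, -1} : Set ℝ),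
            (fun θ => root ε σ αa αb G.t (F θ) - root ε σ αa αb G.t (F θD) - ε * γ * ‖θ - θD‖)
              =O[𝓝[brillouinDiag] θD] (fun θ => ‖θ - θD‖ ^ 2)) ∧
      (αa ≠ αb →
        ∀ σ ∈ ({1, -1} : Set ℝ), ∀ σ' ∈ ({1, -1} : Set ℝ), ∀ θ θ' : Momentum,
          |αa - αb| / (3 + G.t ^ 2) ≤
            root 1 σ αa αb G.t (F θ) - root (-1) σ' αa αb G.t (F θ'))) := by
  let Q : CI := ⟨(Icc (0 : ℝ) 1).domRestrict G.q, hq.domRestrict⟩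
  have hQ : ∀ x, Q x = G.q x := fun _ => rfl
  refine ⟨fun σ hσ θ hθ => F_eq_iff ht hσ hθ, fun θ lam hlam =>
    mem_dispersion_iff_mem_bands ht.1.ne' hq hQ hsym ((sinEnd_ne_zero_iff hq hQ hsym).2 hlam),
    fun hδ _ σ hσ θD hD hF => ⟨fun lam hc hv => ?_, ?_⟩, fun hδ => ⟨?_, ?_, ?_⟩,
    fun αa αb => ⟨?_, fun _ σ _ σ' _ θ θ' => root_gap _ _ _ _ _ _ _⟩⟩
  -- The conduction band forces the Robin function to be `≥ 0`, the valence band `≤ 0`, whatever the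
  -- shifts; a common energy is therefore a zero.
  · obtain ⟨-, σ₁, -, h1⟩ := (mem_band_iff_of_eq hq hQ hsym hδ).1 hc
    obtain ⟨-, σ₂, -, h2⟩ := (mem_band_iff_of_eq hq hQ hsym hδ).1 hv
    refine isDiracCone_of_robin_zero ht hq hQ hsym hδ hσ hD hF (le_antisymm ?_ ?_)
    · rw [h2, neg_one_mul]
      exact neg_nonpos.2 (norm_nonneg _)
    · rw [h1, one_mul]
      exact norm_nonneg _
  · exact (infinite_robin_zeros Q (by positivity : 0 < 3 + G.t ^ 2) G.δa).mono fun mu h0 =>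
      isDiracCone_of_robin_zero ht hq hQ hsym hδ hσ hD hF h0
  · intro lam θ θ' hc hv
    have pc := pos_of_mem_band hq hQ hsym hδ (one_pow 2) hc
    have pv := pos_of_mem_band hq hQ hsym hδ (by norm_num) hv
    linarith
  · intro lc lv θ θ' hc hv
    exact exists_gap_between ht hq hQ hsym hδ hc hv
  · exact infinite_gaps ht hq hQ hsym hδ
  · rintro rfl - σ hσ θD hD hF
    refine ⟨?_, root_linear ht hσ hD hF⟩
    simp [root_eq_of_eq, hF]
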